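/- Let $d\ge 1$ be an integer. A user is at the origin of $\mathbb R^d$. **Path loss.** Let $K\ge 1$, $0=R_0<R_1<\dots<R_K=R_\infty<\infty$, $A_0,\dots,A_{K-1}>0$, $\beta_0\ge 0$, $\beta_k\ge d-1$ for $1\le k\le K-1$, $\beta_k<\beta_{k+1}$ and $A_kR_{k+1}^{\beta_k}=A_{k+1}R_{k+1}^{\beta_{k+1}}$ for $0\le k\le K-2$, and let $l(r)=\sum_{k=0}^{K-1}A_kr^{\beta_k}\mathbf 1(R_k\le r<R_{k+1})$. **Network.** Let $F_m$ be a probability distribution on $[0,\infty)$ that is not concentrated at $0$, and let $W\ge 0$ be a constant. For every $\lambda\ge 0$ let the nodes $\mathbf x_i$ form a homogeneous Poisson point process of intensity $\lambda$ on the ball of radius $R_\infty$ around the origin, and let their fading variables $m_i$ be i.i.d. with distribution $F_m$ and independent of the positions. Put $P_i=m_i/l(\|\mathbf x_i\|)$, $I=\sum_iP_i$, $M=\max_iP_i$ and $Y=Y(\lambda)=M/(I+W-M)$ (the SINR of the user when it is served by the strongest node). The networks for all $\lambda$ live on one probability space. **Tail of the received power.** Let $F_P$ be the distribution of $m/l(\|\mathbf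 x\|)$, where $\mathbf x$ is uniformly distributed on the ball of radius $R_\infty$ and $m$ is independent of $\mathbf x$ with distribution $F_m$, and let $\bar F_P=1-F_P$. A positive measurable function $h$ on $(0,\infty)$ is in $\mathcal R_\rho$, $\rho\in\mathbb R$, if $h(tx)/h(x)\to t^\rho$ as $x\to\infty$ for every $t>0$; it is slowly varying if $\rho=0$, and rapidly varying ($h\in\mathcal R_{-\infty}$) if $h(tx)/h(x)\to 0$ for $t>1$ and $h(tx)/h(x)\to\infty$ for $0<t<1$. Then, as $\lambda\to\infty$: 1. If $\bar F_P\in\mathcal R_0$, then $Y\to\infty$ in probability. 2. If $\bar F_P\in\mathcal R_{-\alpha}$ with $0<\alpha<1$, then $Y$ converges in distribution to a random variable $D$ with a non-degenerate distribution on $\mathbb R$. 3. Suppose that the networks are nested: almost surely, for all $\lambda_1\le\lambda_2$, the nodes at density $\lambda_1$, with their fading variables, are among the nodes at density $\lambda_2$. If $\bar F_P\in\mathcal R_{-\alpha}$ with $\alpha>1$, or if $\bar F_P=o(\bar H)$ at $\infty$ for some $\bar H\in\mathcal R_{-\infty}$, then $Y\to 0$ almost surely. -/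

import Mathlib

open MeasureTheory ProbabilityTheory Filter Topology Set
open scoped NNReal ENNReal

/-! ### Regular variation at infinity -/

/-- A positive Lebesgue (null-)measurable function `h` on `(0, ∞)` is regularly varying at `∞`
with index `α ∈ ℝ` if `h (t x) / h x → t ^ α` as `x → ∞`, for every `t > 0`. -/
structure IsRegularlyVarying (h : ℝ → ℝ) (α : ℝ) : Prop where
  pos : ∀ x, 0 < x → 0 < h x
  meas : AEMeasurable h (volume.restrict (Ioi 0))
  lim : ∀ t : ℝ, 0 < t → Tendsto (fun x => h (t * x) / h x) atTop (𝓝 (t ^ α))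

/-- Slow variation: the index is `0`. -/
def IsSlowlyVarying (h : ℝ → ℝ) : Prop := IsRegularlyVarying h 0

/-- Rapid variation: the index is `-∞`, that is, `h (t x) / h x` tends to `t ^ (-∞)`, which is
`0` for `t > 1` and `∞` for `0 < t < 1`. -/
structure IsRapidlyVarying (h : ℝ → ℝ) : Prop where
  pos : ∀ x, 0 < x → 0 < h x
  meas : AEMeasurable h (volume.restrict (Ioi 0))
  lim_gt : ∀ t : ℝ, 1 < t → Tendsto (fun x => h (t * x) / h x) atTop (𝓝 0)
  lim_lt : ∀ t : ℝ, 0 < t → t < 1 → Tendsto (fun x => h (t * x) / h x) atTop atTop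

/-- The tail (complementary distribution function) `1 - F` of a probability law on `ℝ`. -/
noncomputable def tail (F : Measure ℝ) (t : ℝ) : ℝ := 1 - cdf F t

/-! ### Multi-slope path loss in dimension `d` -/

/-- Parameters of a multi-slope path loss function with `K` slopes on `[0, R K)`. Only `R 0, …, R K`,
`A 0, …, A (K - 1)` and `β 0, …, β (K - 1)` matter. -/
structure MultiSlope (d : ℕ) where
  /-- number of slopes -/
  K : ℕ
  /-- break points; `R K` is the radius of the network domain -/
  R : ℕ → ℝ
  /-- scale constants -/
  A : ℕ → ℝ
  /-- path loss exponents -/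
  β : ℕ → ℝ
  one_le_K : 1 ≤ K
  R_zero : R 0 = 0
  R_lt : ∀ k, k < K → R k < R (k + 1)
  β_zero : 0 ≤ β 0
  β_ge : ∀ k, 1 ≤ k → k < K → (d : ℝ) - 1 ≤ β k
  β_lt : ∀ k, k + 1 < K → β k < β (k + 1)
  A_pos : ∀ k, k < K → 0 < A k
  cont : ∀ k, k + 1 < K → A k * R (k + 1) ^ β k = A (k + 1) * R (k + 1) ^ β (k + 1)

namespace MultiSlope

variable {d : ℕ}

/-- The path loss function `l(r) = ∑ A_k r ^ β_k 1(R_k ≤ r < R_{k+1})`. -/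
noncomputable def loss (ℓ : MultiSlope d) (r : ℝ) : ℝ :=
  ∑ k ∈ Finset.range ℓ.K, (Ico (ℓ.R k) (ℓ.R (k + 1))).indicator (fun s => ℓ.A k * s ^ ℓ.β k) r

/-- The network domain: the ball of radius `R_∞ = R K` around the user, who is at the origin. -/
def domain (ℓ : MultiSlope d) : Set (EuclideanSpace ℝ (Fin d)) := Metric.ball 0 (ℓ.R ℓ.K)

/-- The power `m / l(‖x‖)` received at the origin from a node at `x` with fading variable `m`. -/
noncomputable def power (ℓ : MultiSlope d) (p : EuclideanSpace ℝ (Fin d) × ℝ) : ℝ :=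
  p.2 / ℓ.loss ‖p.1‖

/-- The law `F_P` of the power received from a random node: the node is uniformly distributed on
the network domain, and its fading variable has law `Fm` and is independent of the position. -/
noncomputable def powerLaw (ℓ : MultiSlope d) (Fm : Measure ℝ) : Measure ℝ :=
  ((ProbabilityTheory.cond volume ℓ.domain).prod Fm).map ℓ.power

end MultiSlope

/-! ### Marked Poisson point processes -/

/-- A finite random collection of nodes, enumerated: the nodes are those with index `i < num ω`; node
`i` is at `pos i ω` and has fading variable `mark i ω`. Values at indices `i ≥ num ω` are dummies. -/
structure MarkedNodes (Ω : Type*) (d : ℕ) where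
  num : Ω → ℕ
  pos : ℕ → Ω → EuclideanSpace ℝ (Fin d)
  mark : ℕ → Ω → ℝ

namespace MarkedNodes

variable {Ω : Type*} {d : ℕ}

/-- The number of nodes located in `B`. -/
noncomputable def count (Φ : MarkedNodes Ω d) (B : Set (EuclideanSpace ℝ (Fin d))) (ω : Ω) : ℕ :=
  {i | i < Φ.num ω ∧ Φ.pos i ω ∈ B}.ncard

/-- The realized configuration of marked nodes, as an unordered collection with multiplicity. -/
def config (Φ : MarkedNodes Ω d) (ω : Ω) : Multiset (EuclideanSpace ℝ (Fin d) × ℝ) :=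
  (Multiset.range (Φ.num ω)).map fun i => (Φ.pos i ω, Φ.mark i ω)

/-- The node positions form a Poisson point process with intensity measure `Λ`: the number of nodes
in a set `B` is Poisson with mean `Λ B`, and the numbers of nodes in disjoint sets are independent. -/
structure IsPoisson [MeasurableSpace Ω] (P : Measure Ω) (Λ : Measure (EuclideanSpace ℝ (Fin d)))
    (Φ : MarkedNodes Ω d) : Prop where
  measurable_num : Measurable Φ.num
  measurable_pos : ∀ i, Measurable (Φ.pos i)
  map_count : ∀ B, MeasurableSet B → Λ B ≠ ∞ →
    P.map (Φ.count B) = poissonMeasure (Λ B).toNNReal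
  indep_count : ∀ (n : ℕ) (B : Fin n → Set (EuclideanSpace ℝ (Fin d))),
    (∀ j, MeasurableSet (B j)) → Pairwise (fun j k => Disjoint (B j) (B k)) →
    iIndepFun (fun j => Φ.count (B j)) P

/-- The nodes form a network of density `lam` under path loss `ℓ` and fading law `Fm`: positions are
a homogeneous Poisson point process of intensity `lam` on the network domain, and the fading
variables are i.i.d. with law `Fm` and independent of the positions. -/
structure IsNetwork [MeasurableSpace Ω] (P : Measure Ω) (ℓ : MultiSlope d) (Fm : Measure ℝ)
    (lam : ℝ≥0) (Φ : MarkedNodes Ω d) : Prop where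
  poisson : Φ.IsPoisson P (lam • (volume.restrict ℓ.domain))
  measurable_mark : ∀ i, Measurable (Φ.mark i)
  map_mark : ∀ i, P.map (Φ.mark i) = Fm
  indep_mark : iIndepFun Φ.mark P
  indep_pos_mark : IndepFun (fun ω => (Φ.num ω, fun i => Φ.pos i ω)) (fun ω i => Φ.mark i ω) P

/-- The power received from node `i`. -/
noncomputable def rx (ℓ : MultiSlope d) (Φ : MarkedNodes Ω d) (i : ℕ) (ω : Ω) : ℝ :=
  ℓ.power (Φ.pos i ω, Φ.mark i ω)

/-- The total interference `I`, the sum of the powers received from all the nodes. -/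
noncomputable def totalPower (ℓ : MultiSlope d) (Φ : MarkedNodes Ω d) (ω : Ω) : ℝ :=
  ∑ i ∈ Finset.range (Φ.num ω), Φ.rx ℓ i ω

/-- The maximum received power `M` (which is `0` if there is no node). -/
noncomputable def maxPower (ℓ : MultiSlope d) (Φ : MarkedNodes Ω d) (ω : Ω) : ℝ :=
  ⨆ i : Fin (Φ.num ω), Φ.rx ℓ i ω

/-- The SINR `Y = M / (I + W - M)` from the strongest cell, with noise power `W`. -/
noncomputable def sinr (ℓ : MultiSlope d) (W : ℝ) (Φ : MarkedNodes Ω d) (ω : Ω) : ℝ :=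
  Φ.maxPower ℓ ω / (Φ.totalPower ℓ ω + W - Φ.maxPower ℓ ω)

end MarkedNodes

/-!
The received powers `P_i` form a Poisson process on `[0, ∞)` with intensity measure `μ F`, where `F
= F_P` and `μ` is `λ` times the volume of the domain. All that is used about them is the Laplace
functional `E ∏ g(P_i) = exp (-μ ∫ (1 - g) dF)` for measurable `g` with values in `[0, 1]`
(`MarkedNodes.IsNetwork.isPoissonSample`): for positions and step functions it is the independence
of the counts in disjoint sets, and the marks are integrated out, being independent of the
positions and of each other. The path loss enters only through `F`.

*Heavy tails.* Let `X = (I + W - M) / M`, so that `Y = 1 / X`. The functional with `g(y) = e^{-s y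
/ b} 1(y ≤ a)` gives `E[e^{-s I / b}; M ≤ a]`. On the event `a < M ≤ b`, the number `e^{-s X}` lies
between `e^{s - s I / a}` and `e^{s - s I / b}`, up to the noise term, which is negligible for
large `a`. Summing over the windows `(x₀ qᵏ, x₀ qᵏ⁺¹]` and letting `μ → ∞`, then `q → 1`, yields `E
e^{-s X} → 1 / φ(s)` (`tendsto_integral_exp_nisr`), where `φ(s)` is the limit of `∫ (1 - e^{-s y /
b} 1(y ≤ b)) dF / F̄(b)` as `b → ∞`; a Potter bound makes that limit a case of dominated
convergence (`IsRegularlyVarying.tendsto_integral_one_sub_cutExp_div`). This is where the index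
`-α` has to satisfy `0 ≤ α < 1`.

For `α = 0` one finds `φ = 1`, so `X → 0` in probability. For `0 < α < 1` the moments of `e^{-X}`,
a variable with values in `[0, 1]`, converge, hence so does its law, by compactness and the density
of polynomials. The limit law has no atom at `1` because `φ(k) → ∞`, so the map `e^{-X} ↦ 1 / X` is
almost everywhere continuous, and `Y` converges in distribution. The limit is not a point mass,
since the moments `1 / φ(k)` decay too slowly to be the powers of a number less than `1`.

*Light tails.* Along `λ = 2ⁿ`, one has `P(M > c 2ⁿ) ≤ v 2ⁿ F̄(c 2ⁿ)`, with `v` the volume of the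
domain; the right-hand side is summable because `F̄(2x) / F̄(x)` has a limit less than `1/2`, or
`F̄` is dominated by such a function. A Chernoff bound gives `P(I ≤ κ 2ⁿ)` exponentially small in
`2ⁿ` for small `κ`. By the Borel-Cantelli lemma `M / λ → 0` and `I / λ` stays away from `0` along
powers of two, and by monotonicity in the nested networks the same holds along all `λ`.
-/

/-! ### Laplace functional of a Poisson process -/

theorem integral_pow_poissonMeasure (r : ℝ≥0) (c : ℝ) :
    ∫ n, c ^ n ∂(poissonMeasure r) = Real.exp (-(r * (1 - c))) := by
  rw [integral_poissonMeasure]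
  have h : ∀ n : ℕ, (Real.exp (-(r : ℝ)) * (r : ℝ) ^ n / n.factorial) • c ^ n
      = Real.exp (-(r : ℝ)) * ((r * c) ^ n / n.factorial) := by
    intro n; rw [smul_eq_mul, mul_pow]; ring
  simp_rw [h]
  rw [tsum_mul_left, ← congrFun (NormedSpace.exp_eq_tsum_div (𝔸 := ℝ)) (r * c),
    ← Real.exp_eq_exp_ℝ, ← Real.exp_add]
  congr 1; ring

namespace MarkedNodes

variable {Ω : Type*} {d : ℕ} [MeasurableSpace Ω] {P : Measure Ω}

omit [MeasurableSpace Ω] in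
theorem prod_eq_prod_pow_count {ι : Type*} [Fintype ι] (Φ : MarkedNodes Ω d) (ω : Ω)
    (κ : EuclideanSpace ℝ (Fin d) → ι) (c : ι → ℝ) :
    ∏ i ∈ Finset.range (Φ.num ω), c (κ (Φ.pos i ω)) = ∏ j, c j ^ Φ.count (κ ⁻¹' {j}) ω := by
  classical
  rw [← Finset.prod_fiberwise (Finset.range (Φ.num ω)) (fun i => κ (Φ.pos i ω))]
  refine Finset.prod_congr rfl fun j _ => ?_
  rw [Finset.prod_congr rfl (g := fun _ => c j), Finset.prod_const]
  · congr 1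
    rw [count, ← Set.ncard_coe_finset]
    congr 1
    ext i
    simp
  · intro i hi
    rw [(Finset.mem_filter.1 hi).2]

theorem IsPoisson.aemeasurable_count {Λ : Measure (EuclideanSpace ℝ (Fin d))} [IsFiniteMeasure Λ]
    {Φ : MarkedNodes Ω d} (h : Φ.IsPoisson P Λ) {B : Set (EuclideanSpace ℝ (Fin d))}
    (hB : MeasurableSet B) : AEMeasurable (Φ.count B) P := by
  refine aemeasurable_of_map_neZero ?_
  rw [h.map_count B hB (measure_ne_top _ _)]
  infer_instance

/-- The Laplace functional of a Poisson process at a step function: its factors are the generating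
functions of the independent counts in the cells of a partition. -/
theorem IsPoisson.integral_prod_step [IsProbabilityMeasure P]
    {Λ : Measure (EuclideanSpace ℝ (Fin d))} [IsFiniteMeasure Λ]
    {Φ : MarkedNodes Ω d} (h : Φ.IsPoisson P Λ) {n : ℕ}
    {κ : EuclideanSpace ℝ (Fin d) → Fin n} (hκ : Measurable κ) (c : Fin n → ℝ) :
    ∫ ω, ∏ i ∈ Finset.range (Φ.num ω), c (κ (Φ.pos i ω)) ∂P
      = Real.exp (-∫ x, (1 - c (κ x)) ∂Λ) := by
  have hB : ∀ j, MeasurableSet (κ ⁻¹' {j}) := fun j => hκ (measurableSet_singleton j)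
  simp_rw [prod_eq_prod_pow_count Φ _ κ c]
  have hind := h.indep_count n (fun j => κ ⁻¹' {j}) hB (fun j k hjk =>
    Disjoint.preimage _ (by simpa using hjk))
  rw [hind.integral_fun_prod_comp (f := fun j m => c j ^ m)
    (fun j => h.aemeasurable_count (hB j)) (fun j => .of_discrete)]
  have h1 : ∀ j, ∫ ω, c j ^ Φ.count (κ ⁻¹' {j}) ω ∂P
      = Real.exp (-(Λ.real (κ ⁻¹' {j}) * (1 - c j))) := by
    intro j
    rw [← integral_map (f := fun m : ℕ => c j ^ m) (h.aemeasurable_count (hB j)) .of_discrete,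
      h.map_count _ (hB j) (measure_ne_top _ _), integral_pow_poissonMeasure]
    rfl
  simp_rw [h1]
  rw [← Real.exp_sum, Finset.sum_neg_distrib]
  congr 2
  rw [← integral_map (f := fun j => 1 - c j) hκ.aemeasurable .of_discrete,
    integral_fintype .of_finite]
  refine Finset.sum_congr rfl fun j _ => ?_
  rw [map_measureReal_apply hκ (measurableSet_singleton j), smul_eq_mul]

end MarkedNodes

theorem measurable_prod_range {Ω : Type*} [MeasurableSpace Ω] {N : Ω → ℕ} (hN : Measurable N)
    {f : ℕ → Ω → ℝ} (hf : ∀ i, Measurable (f i)) :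
    Measurable fun ω => ∏ i ∈ Finset.range (N ω), f i ω := by
  have : Measurable fun q : Ω × ℕ => ∏ i ∈ Finset.range q.2, f i q.1 :=
    measurable_from_prod_countable_left fun n =>
      Finset.measurable_fun_prod (Finset.range n) fun i _ => hf i
  exact this.comp (measurable_id.prodMk hN)

theorem tendsto_natFloor_natCast_mul_div {x : ℝ} (hx : 0 ≤ x) :
    Tendsto (fun n : ℕ => (⌊(n : ℝ) * x⌋₊ : ℝ) / n) atTop (𝓝 x) := by
  have := (tendsto_nat_floor_mul_div_atTop (R := ℝ) hx).comp tendsto_natCast_atTop_atTop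
  refine this.congr fun n => ?_
  simp [mul_comm]

namespace MarkedNodes

variable {Ω : Type*} {d : ℕ} [MeasurableSpace Ω] {P : Measure Ω}

/-- The Laplace functional of a Poisson process. -/
theorem IsPoisson.integral_prod [IsProbabilityMeasure P]
    {Λ : Measure (EuclideanSpace ℝ (Fin d))} [IsFiniteMeasure Λ]
    {Φ : MarkedNodes Ω d} (h : Φ.IsPoisson P Λ) {g : EuclideanSpace ℝ (Fin d) → ℝ}
    (hg : Measurable g) (h0 : ∀ x, 0 ≤ g x) (h1 : ∀ x, g x ≤ 1) :
    ∫ ω, ∏ i ∈ Finset.range (Φ.num ω), g (Φ.pos i ω) ∂P = Real.exp (-∫ x, (1 - g x) ∂Λ) := by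
  -- approximate `g` from below by the step functions `⌊n g⌋ / n`
  let gn : ℕ → EuclideanSpace ℝ (Fin d) → ℝ := fun n x => (⌊(n : ℝ) * g x⌋₊ : ℝ) / n
  have hgnm : ∀ n, Measurable (gn n) := fun n => by
    have : Measurable fun x => ⌊(n : ℝ) * g x⌋₊ := Nat.measurable_floor.comp (hg.const_mul _)
    exact ((measurable_from_top (f := fun m : ℕ => (m : ℝ))).comp this).div_const _
  have hgn0 : ∀ n x, 0 ≤ gn n x := fun n x => by positivity
  have hgn1 : ∀ n x, gn n x ≤ 1 := fun n x => by
    refine div_le_one_of_le₀ ?_ (by positivity)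
    refine (Nat.floor_le (mul_nonneg (by positivity) (h0 x))).trans ?_
    exact mul_le_of_le_one_right (by positivity) (h1 x)
  have hlim : ∀ x, Tendsto (fun n => gn n x) atTop (𝓝 (g x)) := fun x =>
    tendsto_natFloor_natCast_mul_div (h0 x)
  have hstep : ∀ n, ∫ ω, ∏ i ∈ Finset.range (Φ.num ω), gn n (Φ.pos i ω) ∂P
      = Real.exp (-∫ x, (1 - gn n x) ∂Λ) := fun n => by
    have hlt : ∀ x, ⌊(n : ℝ) * g x⌋₊ < n + 1 := fun x => by
      rw [Nat.lt_succ_iff]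
      refine Nat.floor_le_of_le ?_
      exact mul_le_of_le_one_right (by positivity) (h1 x)
    have hm : Measurable fun x => (⟨⌊(n : ℝ) * g x⌋₊, hlt x⟩ : Fin (n + 1)) := by
      refine measurable_to_countable' fun j => ?_
      have : Measurable fun x => ⌊(n : ℝ) * g x⌋₊ := Nat.measurable_floor.comp (hg.const_mul _)
      convert! this (measurableSet_singleton (j : ℕ)) using 1
      ext x
      simp [Fin.ext_iff]
    exact h.integral_prod_step hm (fun j => ((j : ℕ) : ℝ) / n)
  refine tendsto_nhds_unique (f := fun n => ∫ ω, ∏ i ∈ Finset.range (Φ.num ω), gn n (Φ.pos i ω) ∂P)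
    (l := atTop) ?_ ?_
  · refine tendsto_integral_of_dominated_convergence (fun _ => 1) (fun n => ?_)
      (integrable_const _) (fun n => ?_) ?_
    · exact (measurable_prod_range h.measurable_num
        fun i => (hgnm n).comp (h.measurable_pos i)).aestronglyMeasurable
    · refine ae_of_all _ fun ω => ?_
      rw [Real.norm_of_nonneg (Finset.prod_nonneg fun i _ => hgn0 n _)]
      exact Finset.prod_le_one (fun i _ => hgn0 n _) (fun i _ => hgn1 n _)
    · exact ae_of_all _ fun ω => tendsto_finsetProd _ fun i _ => hlim _
  · simp_rw [hstep]
    refine (Real.continuous_exp.tendsto _).comp (Tendsto.neg ?_)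
    refine tendsto_integral_of_dominated_convergence (fun _ => 1) (fun n => ?_)
      (integrable_const _) (fun n => ?_) ?_
    · exact ((hgnm n).const_sub 1).aestronglyMeasurable
    · refine ae_of_all _ fun x => ?_
      rw [Real.norm_of_nonneg (sub_nonneg.2 (hgn1 n x))]
      linarith [hgn0 n x]
    · exact ae_of_all _ fun x => (hlim x).const_sub 1

end MarkedNodes

/-! ### The received powers as a Poisson process on the half-line -/

namespace MultiSlope

variable {d : ℕ} (ℓ : MultiSlope d)

theorem measurable_loss : Measurable ℓ.loss := by
  unfold loss
  refine Finset.measurable_fun_sum _ fun k _ => ?_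
  exact (((measurable_id.pow_const _).const_mul _)).indicator measurableSet_Ico

theorem measurable_power : Measurable ℓ.power := by
  unfold power
  exact measurable_snd.div (ℓ.measurable_loss.comp measurable_fst.norm)

theorem R_nonneg {k : ℕ} (hk : k ≤ ℓ.K) : 0 ≤ ℓ.R k := by
  induction k with
  | zero => exact ℓ.R_zero.ge
  | succ k ih => exact (ih (by omega)).trans (ℓ.R_lt k (by omega)).le

theorem R_K_pos : 0 < ℓ.R ℓ.K := by
  have h := ℓ.R_lt (ℓ.K - 1) (by have := ℓ.one_le_K; omega)
  rw [Nat.sub_add_cancel ℓ.one_le_K] at h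
  exact (ℓ.R_nonneg (by omega)).trans_lt h

theorem loss_nonneg (r : ℝ) : 0 ≤ ℓ.loss r := by
  refine Finset.sum_nonneg fun k hk => indicator_nonneg (fun s hs => ?_) r
  have hk := Finset.mem_range.1 hk
  exact mul_nonneg (ℓ.A_pos k hk).le (Real.rpow_nonneg ((ℓ.R_nonneg hk.le).trans hs.1) _)

theorem loss_pos {r : ℝ} (h0 : 0 < r) (h1 : r < ℓ.R ℓ.K) : 0 < ℓ.loss r := by
  obtain ⟨k, hk, hr⟩ : ∃ k < ℓ.K, r ∈ Ico (ℓ.R k) (ℓ.R (k + 1)) := by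
    classical
    have hex : ∃ n, r < ℓ.R n := ⟨_, h1⟩
    have hpos : Nat.find hex ≠ 0 := fun h => by
      have := Nat.find_spec hex
      rw [h, ℓ.R_zero] at this
      linarith
    refine ⟨Nat.find hex - 1, ?_, ?_, ?_⟩
    · have := Nat.find_min' hex h1
      omega
    · exact not_lt.1 (Nat.find_min hex (by omega))
    · rw [Nat.sub_add_cancel (by omega)]
      exact Nat.find_spec hex
  refine Finset.sum_pos' (fun k hk => indicator_nonneg (fun s hs => ?_) r)
    ⟨k, Finset.mem_range.2 hk, ?_⟩
  · have hk := Finset.mem_range.1 hk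
    exact mul_nonneg (ℓ.A_pos k hk).le (Real.rpow_nonneg ((ℓ.R_nonneg hk.le).trans hs.1) _)
  · rw [indicator_of_mem hr]
    exact mul_pos (ℓ.A_pos k hk) (Real.rpow_pos_of_pos h0 _)

theorem power_nonneg {p : EuclideanSpace ℝ (Fin d) × ℝ} (hp : 0 ≤ p.2) : 0 ≤ ℓ.power p :=
  div_nonneg hp (ℓ.loss_nonneg _)

theorem volume_domain_pos : 0 < volume ℓ.domain := Metric.measure_ball_pos _ _ ℓ.R_K_pos

theorem volume_domain_ne_top : volume ℓ.domain ≠ ∞ := measure_ball_lt_top.ne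

theorem isProbabilityMeasure_cond_domain :
    IsProbabilityMeasure (ProbabilityTheory.cond volume ℓ.domain) :=
  cond_isProbabilityMeasure_of_finite ℓ.volume_domain_pos.ne' ℓ.volume_domain_ne_top

theorem isProbabilityMeasure_powerLaw (Fm : Measure ℝ) [IsProbabilityMeasure Fm] :
    IsProbabilityMeasure (ℓ.powerLaw Fm) := by
  have := ℓ.isProbabilityMeasure_cond_domain
  exact Measure.isProbabilityMeasure_map ℓ.measurable_power.aemeasurable

theorem integral_powerLaw (Fm : Measure ℝ) [IsProbabilityMeasure Fm] {f : ℝ → ℝ}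
    (hf : Measurable f) {C : ℝ} (hC : ∀ y, |f y| ≤ C) :
    ∫ y, f y ∂(ℓ.powerLaw Fm) = (volume ℓ.domain).toReal⁻¹ *
      ∫ x in ℓ.domain, ∫ m, f (ℓ.power (x, m)) ∂Fm := by
  have := ℓ.isProbabilityMeasure_cond_domain
  rw [powerLaw, integral_map ℓ.measurable_power.aemeasurable hf.aestronglyMeasurable,
    integral_prod]
  · rw [ProbabilityTheory.cond, integral_smul_measure, smul_eq_mul, ENNReal.toReal_inv]
  · exact (integrable_const C).mono' (hf.comp ℓ.measurable_power).aestronglyMeasurable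
      (ae_of_all _ fun _ => hC _)

/-- Since `Fm` is not concentrated at `0`, the received power is positive with positive probability.
The origin is excluded, because the path loss may vanish there. -/
theorem powerLaw_Ioi_pos (hd : 1 ≤ d) (Fm : Measure ℝ) [IsProbabilityMeasure Fm]
    (h : Fm (Iio 0) = 0) (hne : Fm ≠ Measure.dirac 0) : 0 < ℓ.powerLaw Fm (Ioi 0) := by
  have := ℓ.isProbabilityMeasure_cond_domain
  have : Nonempty (Fin d) := ⟨⟨0, hd⟩⟩
  have hFm : 0 < Fm (Ioi 0) := by
    refine pos_iff_ne_zero.2 fun h0 => hne ?_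
    have hae : ∀ᵐ m ∂Fm, m = 0 := by
      have h1 : ∀ᵐ m ∂Fm, m ∉ Iio (0 : ℝ) := measure_eq_zero_iff_ae_notMem.1 h
      have h2 : ∀ᵐ m ∂Fm, m ∉ Ioi (0 : ℝ) := measure_eq_zero_iff_ae_notMem.1 h0
      filter_upwards [h1, h2] with m a b using le_antisymm (not_lt.1 b) (not_lt.1 a)
    have : Fm.map id = Fm.map fun _ => (0 : ℝ) := Measure.map_congr hae
    rwa [Measure.map_id, Measure.map_const, measure_univ, one_smul] at this
  have hdom : 0 < ProbabilityTheory.cond volume ℓ.domain (ℓ.domain \ {0}) := by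
    have h1 : ProbabilityTheory.cond volume ℓ.domain ({0} : Set (EuclideanSpace ℝ (Fin d))) = 0 :=
      cond_absolutelyContinuous (by simp)
    rw [measure_sdiff_null h1, cond_apply_self]
    · simp
    · exact ℓ.volume_domain_pos.ne'
    · exact ℓ.volume_domain_ne_top
  rw [powerLaw, Measure.map_apply ℓ.measurable_power measurableSet_Ioi]
  refine lt_of_lt_of_le ?_ (measure_mono (s := (ℓ.domain \ {0}) ×ˢ Ioi 0) fun p hp => ?_)
  · rw [Measure.prod_prod]
    exact ENNReal.mul_pos hdom.ne' hFm.ne'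
  · exact div_pos hp.2 (ℓ.loss_pos (norm_pos_iff.2 hp.1.2) (mem_ball_zero_iff.1 hp.1.1))

end MultiSlope

/-- The numbers `p 0, …, p (N - 1)` are the points of a Poisson process on `[0, ∞)` with intensity
measure `μ F`, as expressed by its Laplace functional. -/
structure IsPoissonSample {Ω : Type*} [MeasurableSpace Ω] (P : Measure Ω) (F : Measure ℝ) (μ : ℝ)
    (N : Ω → ℕ) (p : ℕ → Ω → ℝ) : Prop where
  measurable_num : Measurable N
  measurable_point : ∀ i, Measurable (p i)
  nonneg : ∀ᵐ ω ∂P, ∀ i, 0 ≤ p i ω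
  integral_prod : ∀ g : ℝ → ℝ, Measurable g → (∀ y, 0 ≤ g y) → (∀ y, g y ≤ 1) →
    ∫ ω, ∏ i ∈ Finset.range (N ω), g (p i ω) ∂P = Real.exp (-(μ * ∫ y, (1 - g y) ∂F))

namespace MarkedNodes

variable {Ω : Type*} {d : ℕ} [MeasurableSpace Ω] {P : Measure Ω} [IsProbabilityMeasure P]
  {ℓ : MultiSlope d} {Fm : Measure ℝ} [IsProbabilityMeasure Fm] {lam : ℝ≥0} {Φ : MarkedNodes Ω d}

/-- Given the positions, the marks can be integrated out one by one. -/
theorem IsNetwork.integral_prod (h : Φ.IsNetwork P ℓ Fm lam)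
    {f : EuclideanSpace ℝ (Fin d) × ℝ → ℝ}
    (hf : Measurable f) (h0 : ∀ x, 0 ≤ f x) (h1 : ∀ x, f x ≤ 1) :
    ∫ ω, ∏ i ∈ Finset.range (Φ.num ω), f (Φ.pos i ω, Φ.mark i ω) ∂P
      = ∫ ω, ∏ i ∈ Finset.range (Φ.num ω), (∫ m, f (Φ.pos i ω, m) ∂Fm) ∂P := by
  have hXm : Measurable fun ω => (Φ.num ω, fun i => Φ.pos i ω) :=
    h.poisson.measurable_num.prodMk (measurable_pi_lambda _ h.poisson.measurable_pos)
  have hYm : Measurable fun ω i => Φ.mark i ω := measurable_pi_lambda _ h.measurable_mark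
  have hind := (indepFun_iff_map_prod_eq_prod_map_map hXm.aemeasurable hYm.aemeasurable).1
    h.indep_pos_mark
  let H : (ℕ × (ℕ → EuclideanSpace ℝ (Fin d))) × (ℕ → ℝ) → ℝ :=
    fun q => ∏ i ∈ Finset.range q.1.1, f (q.1.2 i, q.2 i)
  have hH : Measurable H := measurable_prod_range
    (N := fun q : (ℕ × (ℕ → EuclideanSpace ℝ (Fin d))) × (ℕ → ℝ) => q.1.1)
    (f := fun i q => f (q.1.2 i, q.2 i)) (by fun_prop) (fun i => hf.comp (by fun_prop))
  have := Measure.isProbabilityMeasure_map (μ := P) hXm.aemeasurable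
  have := Measure.isProbabilityMeasure_map (μ := P) hYm.aemeasurable
  have hfm : Measurable fun x => ∫ m, f (x, m) ∂Fm :=
    hf.stronglyMeasurable.integral_prod_right'.measurable
  calc ∫ ω, ∏ i ∈ Finset.range (Φ.num ω), f (Φ.pos i ω, Φ.mark i ω) ∂P
      = ∫ q, H q ∂(P.map fun ω => ((Φ.num ω, fun i => Φ.pos i ω), fun i => Φ.mark i ω)) :=
        (integral_map (hXm.prodMk hYm).aemeasurable hH.aestronglyMeasurable).symm
    _ = ∫ a, ∫ b, H (a, b) ∂(P.map fun ω i => Φ.mark i ω)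
          ∂(P.map fun ω => (Φ.num ω, fun i => Φ.pos i ω)) := by
        rw [hind, MeasureTheory.integral_prod]
        refine (integrable_const (1 : ℝ)).mono' hH.aestronglyMeasurable (ae_of_all _ fun q => ?_)
        rw [Real.norm_of_nonneg (Finset.prod_nonneg fun i _ => h0 _)]
        exact Finset.prod_le_one (fun i _ => h0 _) (fun i _ => h1 _)
    _ = ∫ a, ∏ i ∈ Finset.range a.1, (∫ m, f (a.2 i, m) ∂Fm)
          ∂(P.map fun ω => (Φ.num ω, fun i => Φ.pos i ω)) := by
        refine integral_congr_ae (ae_of_all _ fun a => ?_)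
        have hHa : Measurable fun b => H (a, b) := hH.comp (by fun_prop)
        have hi : iIndepFun (fun (i : Fin a.1) => Φ.mark i) P :=
          h.indep_mark.precomp Fin.val_injective
        change ∫ b, H (a, b) ∂_ = _
        rw [integral_map hYm.aemeasurable hHa.aestronglyMeasurable]
        simp only [H, Finset.prod_range]
        rw [hi.integral_fun_prod_comp (X := fun i : Fin a.1 => Φ.mark i)
          (f := fun (i : Fin a.1) m => f (a.2 i, m))
          (fun i => (h.measurable_mark i).aemeasurable)
          (fun i => (hf.comp (by fun_prop)).aestronglyMeasurable)]
        refine Finset.prod_congr rfl fun i _ => ?_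
        rw [← h.map_mark i,
          integral_map (f := fun m => f (a.2 i, m)) (h.measurable_mark i).aemeasurable
          (hf.comp (by fun_prop)).aestronglyMeasurable]
    _ = _ := integral_map hXm.aemeasurable (measurable_prod_range
        (N := fun q : ℕ × (ℕ → EuclideanSpace ℝ (Fin d)) => q.1)
        (f := fun i q => ∫ m, f (q.2 i, m) ∂Fm) (by fun_prop)
        (fun i => hfm.comp (by fun_prop))).aestronglyMeasurable

omit [IsProbabilityMeasure P] [IsProbabilityMeasure Fm] in
theorem measurable_rx (h : Φ.IsNetwork P ℓ Fm lam) (i : ℕ) : Measurable (Φ.rx ℓ i) :=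
  ℓ.measurable_power.comp ((h.poisson.measurable_pos i).prodMk (h.measurable_mark i))

omit [IsProbabilityMeasure P] [IsProbabilityMeasure Fm] in
theorem IsNetwork.ae_mark_nonneg (h : Φ.IsNetwork P ℓ Fm lam) (hFm : Fm (Iio 0) = 0) :
    ∀ᵐ ω ∂P, ∀ i, 0 ≤ Φ.mark i ω := by
  rw [ae_all_iff]
  intro i
  have : P (Φ.mark i ⁻¹' Iio 0) = 0 := by
    rw [← Measure.map_apply (h.measurable_mark i) measurableSet_Iio, h.map_mark i, hFm]
  filter_upwards [measure_eq_zero_iff_ae_notMem.1 this] with ω hω using not_lt.1 hω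

/-- The powers received from a network form a Poisson process on `[0, ∞)`, with intensity measure a
multiple of `F_P`. -/
theorem IsNetwork.isPoissonSample (h : Φ.IsNetwork P ℓ Fm lam) (hFm : Fm (Iio 0) = 0) :
    IsPoissonSample P (ℓ.powerLaw Fm) (lam * (volume ℓ.domain).toReal) Φ.num (Φ.rx ℓ) where
  measurable_num := h.poisson.measurable_num
  measurable_point := measurable_rx h
  nonneg := by
    filter_upwards [h.ae_mark_nonneg hFm] with ω hω i using ℓ.power_nonneg (hω i)
  integral_prod g hg h0 h1 := by
    have hfin : IsFiniteMeasure (volume.restrict ℓ.domain) :=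
      ⟨by simpa using ℓ.volume_domain_ne_top.lt_top⟩
    have hgp : Measurable fun q => g (ℓ.power q) := hg.comp ℓ.measurable_power
    have hint : ∀ x, Integrable (fun m => g (ℓ.power (x, m))) Fm := fun x =>
      (integrable_const (1 : ℝ)).mono' (hgp.comp (by fun_prop)).aestronglyMeasurable
        (ae_of_all _ fun m => by rw [Real.norm_of_nonneg (h0 _)]; exact h1 _)
    have hv : (volume ℓ.domain).toReal ≠ 0 :=
      (ENNReal.toReal_pos ℓ.volume_domain_pos.ne' ℓ.volume_domain_ne_top).ne'
    change ∫ ω, ∏ i ∈ Finset.range (Φ.num ω), g (ℓ.power (Φ.pos i ω, Φ.mark i ω)) ∂P = _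
    rw [h.integral_prod (f := fun q => g (ℓ.power q)) hgp (fun _ => h0 _) (fun _ => h1 _),
      h.poisson.integral_prod (g := fun x => ∫ m, g (ℓ.power (x, m)) ∂Fm)
        hgp.stronglyMeasurable.integral_prod_right'.measurable
        (fun x => integral_nonneg fun _ => h0 _)
        (fun x => (integral_mono (hint x) (integrable_const 1) fun _ => h1 _).trans (by simp)),
      ℓ.integral_powerLaw Fm (f := fun y => 1 - g y) (hg.const_sub 1) (C := 1)
        (fun y => abs_le.2 ⟨by linarith [h1 y], by linarith [h0 y]⟩)]
    congr 2
    rw [mul_assoc, mul_inv_cancel_left₀ hv, integral_smul_nnreal_measure]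
    change (lam : ℝ) * _ = _
    congr 1
    refine integral_congr_ae (ae_of_all _ fun x => ?_)
    change 1 - ∫ m, g (ℓ.power (x, m)) ∂Fm = ∫ m, (1 - g (ℓ.power (x, m))) ∂Fm
    rw [integral_sub (integrable_const _) (hint x)]
    simp

end MarkedNodes

/-! ### Regularly varying tails -/

section Tail

variable {F : Measure ℝ} [IsProbabilityMeasure F]

theorem tail_eq_real_Ioi (t : ℝ) : tail F t = F.real (Ioi t) := by
  rw [tail, cdf_eq_real, ← compl_Iic, probReal_compl_eq_one_sub measurableSet_Iic]

theorem tail_nonneg (t : ℝ) : 0 ≤ tail F t := by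
  rw [tail_eq_real_Ioi]; exact measureReal_nonneg

theorem tail_le_one (t : ℝ) : tail F t ≤ 1 := by
  rw [tail_eq_real_Ioi]; exact measureReal_le_one

omit [IsProbabilityMeasure F] in
theorem antitone_tail : Antitone (tail F) := fun _ _ h =>
  sub_le_sub_left (monotone_cdf F h) 1

omit [IsProbabilityMeasure F] in
theorem tendsto_tail_atTop : Tendsto (tail F) atTop (𝓝 0) := by
  simpa [tail] using! (tendsto_cdf_atTop F).const_sub 1

omit [IsProbabilityMeasure F] in
theorem measurable_tail : Measurable (tail F) := antitone_tail.measurable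

theorem tail_sub_tail {a b : ℝ} (h : a ≤ b) : tail F a - tail F b = F.real (Ioc a b) := by
  rw [tail_eq_real_Ioi, tail_eq_real_Ioi, ← Ioi_sdiff_Ioi,
    measureReal_sdiff (Ioi_subset_Ioi h) measurableSet_Ioi]

end Tail

/-- A Potter bound: a nonincreasing `G` with values in `(0, 1]` that is regularly varying with index
`-α` is dominated, on all of `(0, b]`, by a power of any exponent `δ > α`. -/
theorem IsRegularlyVarying.exists_le_rpow_mul {G : ℝ → ℝ} {α δ : ℝ}
    (hG : IsRegularlyVarying G (-α)) (hanti : Antitone G) (h1 : ∀ x, G x ≤ 1)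
    (hδ0 : 0 ≤ δ) (hαδ : α < δ) :
    ∃ C x₀ : ℝ, 0 < x₀ ∧ ∀ b, x₀ ≤ b → ∀ u, 0 < u → u ≤ 1 → G (b * u) ≤ C * u ^ (-δ) * G b := by
  have hev : ∀ᶠ x in atTop, G (2⁻¹ * x) / G x < 2 ^ δ := by
    refine (hG.lim 2⁻¹ (by norm_num)).eventually_lt_const ?_
    rw [Real.inv_rpow (by norm_num), Real.rpow_neg (by norm_num), inv_inv]
    exact Real.rpow_lt_rpow_of_exponent_lt (by norm_num) hαδ
  obtain ⟨x₁, hx₁⟩ := eventually_atTop.1 hev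
  set x₀ := max x₁ 1 with hx₀
  have hx₀pos : 0 < x₀ := lt_of_lt_of_le one_pos (le_max_right _ _)
  have hhalf : ∀ x, x₀ ≤ x → G (x / 2) ≤ 2 ^ δ * G x := fun x hx => by
    have := hx₁ x ((le_max_left _ _).trans hx)
    rw [div_lt_iff₀ (hG.pos x (hx₀pos.trans_le hx))] at this
    rw [div_eq_inv_mul]
    exact this.le
  have key : ∀ n : ℕ, ∀ y x, x₀ ≤ y → y ≤ x → x ≤ 2 ^ n * y →
      G y ≤ 2 ^ δ * (x / y) ^ δ * G x := by
    intro n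
    induction n with
    | zero =>
      intro y x hy hyx hxy
      have hy0 := hx₀pos.trans_le hy
      obtain rfl : x = y := le_antisymm (by simpa using hxy) hyx
      rw [div_self hy0.ne', Real.one_rpow, mul_one]
      exact le_mul_of_one_le_left (hG.pos x hy0).le (Real.one_le_rpow (by norm_num) hδ0)
    | succ n ih =>
      intro y x hy hyx hxy
      have hy0 := hx₀pos.trans_le hy
      have hx0 := hy0.trans_le hyx
      have h2 := hhalf x (hy.trans hyx)
      rcases le_or_gt x (2 * y) with hle | hlt
      · calc G y ≤ G (x / 2) := hanti (by linarith)
          _ ≤ 2 ^ δ * G x := h2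
          _ ≤ 2 ^ δ * (x / y) ^ δ * G x := by
            refine mul_le_mul_of_nonneg_right ?_ (hG.pos x hx0).le
            exact le_mul_of_one_le_right (by positivity)
              (Real.one_le_rpow ((one_le_div hy0).2 hyx) hδ0)
      · calc G y ≤ 2 ^ δ * (x / 2 / y) ^ δ * G (x / 2) :=
              ih y (x / 2) hy (by linarith) (by rw [pow_succ] at hxy; linarith)
          _ ≤ 2 ^ δ * (x / 2 / y) ^ δ * (2 ^ δ * G x) := by gcongr
          _ = 2 ^ δ * ((x / 2 / y) ^ δ * 2 ^ δ) * G x := by ring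
          _ = 2 ^ δ * (x / y) ^ δ * G x := by
            rw [← Real.mul_rpow (by positivity) (by norm_num)]
            congr 3
            field_simp
  have hGx₀ := hG.pos x₀ hx₀pos
  refine ⟨(G x₀)⁻¹ * 2 ^ δ, x₀, hx₀pos, fun b hb u hu hu1 => ?_⟩
  have hb0 := hx₀pos.trans_le hb
  -- `bu` may fall below the threshold `x₀`: replace it by `y`
  set y := max (b * u) x₀ with hy
  have hyb : y ≤ b := max_le (mul_le_of_le_one_right hb0.le hu1) hb
  have hy0 : 0 < y := hx₀pos.trans_le (le_max_right _ _)
  have hyu : b / y ≤ u⁻¹ := by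
    rw [div_le_iff₀ hy0, ← div_eq_inv_mul, le_div_iff₀ hu]
    exact le_max_left _ _
  have hfirst : G (b * u) ≤ (G x₀)⁻¹ * G y := by
    rcases le_total x₀ (b * u) with h | h
    · rw [hy, max_eq_left h]
      refine le_mul_of_one_le_left (hG.pos _ (by positivity)).le ?_
      exact (one_le_inv₀ hGx₀).2 (h1 _)
    · rw [hy, max_eq_right h, inv_mul_cancel₀ hGx₀.ne']
      exact h1 _
  obtain ⟨n, hn⟩ := pow_unbounded_of_one_lt (b / y) (one_lt_two (α := ℝ))
  have hsec := key n y b (le_max_right _ _) hyb ((div_le_iff₀ hy0).1 hn.le)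
  calc G (b * u) ≤ (G x₀)⁻¹ * G y := hfirst
    _ ≤ (G x₀)⁻¹ * (2 ^ δ * (b / y) ^ δ * G b) := by gcongr
    _ ≤ (G x₀)⁻¹ * (2 ^ δ * (u⁻¹) ^ δ * G b) := by
      have := (hG.pos b hb0).le
      gcongr
    _ = (G x₀)⁻¹ * 2 ^ δ * u ^ (-δ) * G b := by
      rw [Real.inv_rpow hu.le, Real.rpow_neg hu.le]; ring

/-- The function `s ↦ e^{-s} + ∫₀¹ s e^{-su} u^{-α} du = 1 + ∫₀¹ (1 - e^{-su}) α u^{-α-1} du`, whose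
reciprocal is the Laplace transform of the limit law of `(I - M) / M`. -/
noncomputable def limitExponent (α s : ℝ) : ℝ :=
  Real.exp (-s) + ∫ u in Ioc (0 : ℝ) 1, s * Real.exp (-(s * u)) * u ^ (-α)

/-- The factor that a point `y` contributes to `e^{-s I / b} 1(M ≤ a)`. -/
noncomputable def cutExp (s b a y : ℝ) : ℝ :=
  if y ≤ a then Real.exp (-(s * max y 0 / b)) else 0

theorem measurable_cutExp (s b a : ℝ) : Measurable (cutExp s b a) :=
  Measurable.ite measurableSet_Iic (by fun_prop) measurable_const

theorem cutExp_nonneg (s b a y : ℝ) : 0 ≤ cutExp s b a y := by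
  unfold cutExp; split_ifs <;> positivity

theorem cutExp_le_one {s b : ℝ} (hs : 0 ≤ s) (hb : 0 ≤ b) (a y : ℝ) : cutExp s b a y ≤ 1 := by
  unfold cutExp
  split_ifs
  · rw [Real.exp_le_one_iff, neg_nonpos]; positivity
  · exact zero_le_one

theorem integrable_one_sub_cutExp {F : Measure ℝ} [IsFiniteMeasure F] {s b : ℝ} (hs : 0 ≤ s)
    (hb : 0 ≤ b) (a : ℝ) : Integrable (fun y => 1 - cutExp s b a y) F :=
  (integrable_const (1 : ℝ)).mono' ((measurable_cutExp s b a).const_sub 1).aestronglyMeasurable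
    (ae_of_all _ fun y => by
      rw [Real.norm_of_nonneg (sub_nonneg.2 (cutExp_le_one hs hb a y))]
      linarith [cutExp_nonneg s b a y])

theorem integral_Ioo_exp {s c : ℝ} (hc : 0 ≤ c) :
    ∫ u in Ioo 0 c, s * Real.exp (-(s * u)) = 1 - Real.exp (-(s * c)) := by
  rw [← integral_Ioc_eq_integral_Ioo, ← intervalIntegral.integral_of_le hc]
  have h : ∀ u ∈ uIcc 0 c, HasDerivAt (fun u => -Real.exp (-(s * u)))
      (s * Real.exp (-(s * u))) u := fun u _ => by
    have := (((hasDerivAt_id u).const_mul s).neg.exp).neg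
    convert! this using 1
    simp; ring
  rw [intervalIntegral.integral_eq_sub_of_hasDerivAt h
    ((by fun_prop : Continuous fun u => s * Real.exp (-(s * u))).intervalIntegrable _ _)]
  simp; ring

/-- Writing `1 - cutExp` as a mixture of indicators of half-lines turns its integral against `F`
into an integral of the tail of `F`. -/
theorem one_sub_cutExp_eq {s b : ℝ} (hb : 0 < b) (y : ℝ) :
    1 - cutExp s b b y = Real.exp (-s) * (Ioi b).indicator 1 y +
      ∫ u in Ioc (0 : ℝ) 1, s * Real.exp (-(s * u)) * (Ioi (b * u)).indicator 1 y := by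
  have hind : ∀ u, s * Real.exp (-(s * u)) * (Ioi (b * u)).indicator 1 y
      = (Iio (y / b)).indicator (fun u => s * Real.exp (-(s * u))) u := fun u => by
    have : y ∈ Ioi (b * u) ↔ u ∈ Iio (y / b) := by
      rw [mem_Ioi, mem_Iio, lt_div_iff₀ hb, mul_comm]
    by_cases h : u ∈ Iio (y / b)
    · rw [indicator_of_mem h, indicator_of_mem (this.2 h)]; simp
    · rw [indicator_of_notMem h, indicator_of_notMem (fun h' => h (this.1 h'))]; simp
  simp_rw [hind]
  rw [setIntegral_indicator measurableSet_Iio]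
  rcases le_or_gt y b with hy | hy
  · have hset : Ioc (0 : ℝ) 1 ∩ Iio (y / b) = Ioo 0 (max y 0 / b) := by
      ext u
      have h1 : y / b ≤ 1 := (div_le_one hb).2 hy
      simp only [mem_inter_iff, mem_Ioc, mem_Iio, mem_Ioo]
      constructor
      · rintro ⟨⟨a, _⟩, c⟩
        exact ⟨a, c.trans_le (by gcongr; exact le_max_left _ _)⟩
      · rintro ⟨a, c⟩
        rcases le_total y 0 with h0 | h0
        · rw [max_eq_right h0, zero_div] at c
          exact absurd a c.not_gt
        · rw [max_eq_left h0] at c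
          exact ⟨⟨a, (c.trans_le h1).le⟩, c⟩
    rw [hset, integral_Ioo_exp (by positivity), indicator_of_notMem (by simpa using hy),
      cutExp, if_pos hy, mul_div_assoc]
    ring
  · have hset : Ioc (0 : ℝ) 1 ∩ Iio (y / b) = Ioc 0 1 :=
      inter_eq_left.2 fun u hu => hu.2.trans_lt ((one_lt_div hb).2 hy)
    rw [hset, integral_Ioc_eq_integral_Ioo, integral_Ioo_exp zero_le_one,
      indicator_of_mem (by simpa using hy), cutExp, if_neg hy.not_ge]
    simp

section

variable {F : Measure ℝ} [IsProbabilityMeasure F]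

theorem integral_one_sub_cutExp {s b : ℝ} (hs : 0 ≤ s) (hb : 0 < b) :
    ∫ y, (1 - cutExp s b b y) ∂F = Real.exp (-s) * tail F b +
      ∫ u in Ioc (0 : ℝ) 1, s * Real.exp (-(s * u)) * tail F (b * u) := by
  have hbd : ∀ u ∈ Ioc (0 : ℝ) 1, s * Real.exp (-(s * u)) ≤ s := fun u hu =>
    mul_le_of_le_one_right hs (Real.exp_le_one_iff.2 (by have := hu.1; rw [neg_nonpos]; positivity))
  have hmeas : Measurable fun q : ℝ × ℝ =>
      s * Real.exp (-(s * q.2)) * (Ioi (b * q.2)).indicator (1 : ℝ → ℝ) q.1 := by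
    refine Measurable.mul (by fun_prop) ?_
    have : (fun q : ℝ × ℝ => (Ioi (b * q.2)).indicator (1 : ℝ → ℝ) q.1)
        = {q : ℝ × ℝ | b * q.2 < q.1}.indicator 1 := by
      ext q; simp [indicator]
    rw [this]
    exact measurable_one.indicator (measurableSet_lt (by fun_prop) (by fun_prop))
  have hint : Integrable (fun q : ℝ × ℝ =>
      s * Real.exp (-(s * q.2)) * (Ioi (b * q.2)).indicator (1 : ℝ → ℝ) q.1)
      (F.prod (volume.restrict (Ioc (0 : ℝ) 1))) := by
    refine (integrable_const s).mono' hmeas.aestronglyMeasurable ?_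
    have : ∀ᵐ q ∂(F.prod (volume.restrict (Ioc (0 : ℝ) 1))), q.2 ∈ Ioc (0 : ℝ) 1 :=
      Measure.quasiMeasurePreserving_snd.ae (ae_restrict_mem measurableSet_Ioc)
    filter_upwards [this] with q hq
    have h0 : 0 ≤ (Ioi (b * q.2)).indicator (1 : ℝ → ℝ) q.1 :=
      indicator_nonneg (fun _ _ => zero_le_one) _
    have h1 : (Ioi (b * q.2)).indicator (1 : ℝ → ℝ) q.1 ≤ 1 :=
      indicator_le_self' (fun _ _ => zero_le_one) _
    rw [Real.norm_of_nonneg (by positivity)]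
    exact (mul_le_of_le_one_right (by positivity) h1).trans (hbd _ hq)
  have htail : ∀ t, ∫ y, (Ioi t).indicator (1 : ℝ → ℝ) y ∂F = tail F t := fun t => by
    rw [integral_indicator_one measurableSet_Ioi, tail_eq_real_Ioi]
  simp_rw [one_sub_cutExp_eq hb]
  rw [integral_add, integral_const_mul, htail, integral_integral_swap hint]
  · simp_rw [integral_const_mul, htail]
  · exact ((integrable_const (1 : ℝ)).indicator measurableSet_Ioi).const_mul _
  · exact hint.integral_prod_left

/-- An Abelian theorem: integrated against a law with a regularly varying tail, `1 - e^{-s y / b}`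
is of the order of the tail at `b`. -/
theorem IsRegularlyVarying.tendsto_integral_one_sub_cutExp_div {α s : ℝ}
    (hF : IsRegularlyVarying (tail F) (-α)) (hα0 : 0 ≤ α) (hα1 : α < 1) (hs : 0 ≤ s) :
    Tendsto (fun b => (∫ y, (1 - cutExp s b b y) ∂F) / tail F b) atTop
      (𝓝 (limitExponent α s)) := by
  obtain ⟨δ, hαδ, hδ1⟩ := exists_between hα1
  obtain ⟨C, x₀, hx₀, hC⟩ := hF.exists_le_rpow_mul antitone_tail tail_le_one
    (hα0.trans hαδ.le) hαδ
  have heq : (fun b => Real.exp (-s) + ∫ u in Ioc (0 : ℝ) 1,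
      s * Real.exp (-(s * u)) * (tail F (u * b) / tail F b)) =ᶠ[atTop]
      fun b => (∫ y, (1 - cutExp s b b y) ∂F) / tail F b := by
    filter_upwards [eventually_gt_atTop 0] with b hb
    have := hF.pos b hb
    rw [integral_one_sub_cutExp hs hb, add_div, mul_div_cancel_right₀ _ this.ne',
      ← integral_div]
    congr 2
    ext u
    rw [mul_comm u b, mul_div_assoc]
  refine Tendsto.congr' heq (Tendsto.const_add _ ?_)
  refine tendsto_integral_filter_of_dominated_convergence (fun u => s * (C * u ^ (-δ))) ?_ ?_ ?_ ?_
  · refine Eventually.of_forall fun b => Measurable.aestronglyMeasurable ?_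
    refine Measurable.mul (by fun_prop) (Measurable.div_const ?_ _)
    exact measurable_tail.comp (by fun_prop)
  · filter_upwards [eventually_ge_atTop x₀] with b hb
    refine ae_restrict_of_forall_mem measurableSet_Ioc fun u hu => ?_
    have hpos := hF.pos b (hx₀.trans_le hb)
    rw [Real.norm_of_nonneg (mul_nonneg (by positivity)
      (div_nonneg (tail_nonneg _) (tail_nonneg _)))]
    refine mul_le_mul ?_ ?_ (div_nonneg (tail_nonneg _) (tail_nonneg _)) hs
    · exact mul_le_of_le_one_right hs
        (Real.exp_le_one_iff.2 (by have := hu.1; rw [neg_nonpos]; positivity))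
    · rw [div_le_iff₀ hpos, mul_comm u b]
      exact hC b hb u hu.1 hu.2
  · refine Integrable.const_mul (Integrable.const_mul ?_ _) _
    exact (intervalIntegrable_iff_integrableOn_Ioc_of_le zero_le_one).1
      (intervalIntegral.intervalIntegrable_rpow' (by linarith))
  · refine ae_restrict_of_forall_mem measurableSet_Ioc fun u hu => ?_
    exact (hF.lim u hu.1).const_mul _

end

theorem limitExponent_zero_left {s : ℝ} : limitExponent 0 s = 1 := by
  have : ∀ u : ℝ, s * Real.exp (-(s * u)) * u ^ (-(0 : ℝ)) = s * Real.exp (-(s * u)) :=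
    fun u => by simp
  simp_rw [limitExponent, this]
  rw [integral_Ioc_eq_integral_Ioo, integral_Ioo_exp zero_le_one]
  simp

theorem integrableOn_limitExponent {α s : ℝ} (hα : α < 1) :
    IntegrableOn (fun u : ℝ => s * Real.exp (-(s * u)) * u ^ (-α)) (Ioc 0 1) := by
  rw [← intervalIntegrable_iff_integrableOn_Ioc_of_le zero_le_one]
  exact (intervalIntegral.intervalIntegrable_rpow' (by linarith)).continuousOn_mul (by fun_prop)

theorem limitExponent_pos {α s : ℝ} (hs : 0 ≤ s) : 0 < limitExponent α s := by
  refine add_pos_of_pos_of_nonneg (Real.exp_pos _) ?_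
  refine setIntegral_nonneg measurableSet_Ioc fun u hu => ?_
  have := hu.1.le
  positivity

theorem limitExponent_le {α s : ℝ} (hα : α < 1) (hs : 0 ≤ s) :
    limitExponent α s ≤ 1 + s * (1 - α)⁻¹ := by
  refine add_le_add (Real.exp_le_one_iff.2 (by linarith)) ?_
  have hint : IntegrableOn (fun u : ℝ => s * u ^ (-α)) (Ioc 0 1) := by
    rw [← intervalIntegrable_iff_integrableOn_Ioc_of_le zero_le_one]
    exact (intervalIntegral.intervalIntegrable_rpow' (by linarith)).const_mul _
  refine (setIntegral_mono_on (integrableOn_limitExponent hα) hint measurableSet_Ioc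
    fun u hu => ?_).trans ?_
  · have := hu.1.le
    refine mul_le_mul_of_nonneg_right ?_ (by positivity)
    exact mul_le_of_le_one_right hs (Real.exp_le_one_iff.2 (by rw [neg_nonpos]; positivity))
  · rw [integral_const_mul, ← intervalIntegral.integral_of_le zero_le_one,
      integral_rpow (Or.inl (by linarith))]
    rw [Real.one_rpow, Real.zero_rpow (by linarith), sub_zero, one_div, neg_add_eq_sub]

/-- The part of the integral over `u < 1 / s` already grows like `s ^ α`. -/
theorem rpow_mul_le_limitExponent {α s : ℝ} (hα0 : 0 ≤ α) (hα1 : α < 1) (hs : 1 ≤ s) :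
    (1 - Real.exp (-1)) * s ^ α ≤ limitExponent α s := by
  have hs0 : 0 < s := by linarith
  have hsub : Ioo (0 : ℝ) s⁻¹ ⊆ Ioc 0 1 := fun u hu =>
    ⟨hu.1, hu.2.le.trans (inv_le_one_of_one_le₀ hs)⟩
  have h1 : ∫ u in Ioo (0 : ℝ) s⁻¹, s * Real.exp (-(s * u)) * s ^ α
      ≤ ∫ u in Ioc (0 : ℝ) 1, s * Real.exp (-(s * u)) * u ^ (-α) := by
    refine le_trans (setIntegral_mono_on ?_ ((integrableOn_limitExponent hα1).mono_set hsub)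
      measurableSet_Ioo fun u hu => ?_)
      (setIntegral_mono_set (integrableOn_limitExponent hα1) ?_ hsub.eventuallyLE)
    · exact ((by fun_prop : Continuous fun u => s * Real.exp (-(s * u)) * s ^ α)
        |>.integrableOn_Icc).mono_set Ioo_subset_Icc_self
    · have hu0 := hu.1
      gcongr
      rw [Real.rpow_neg hu0.le, ← Real.inv_rpow hu0.le]
      exact Real.rpow_le_rpow hs0.le ((le_inv_comm₀ hs0 hu0).2 hu.2.le) hα0
    · refine ae_restrict_of_forall_mem measurableSet_Ioc fun u hu => ?_
      have := hu.1.le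
      simp only [Pi.zero_apply]
      positivity
  rw [integral_mul_const, integral_Ioo_exp (by positivity), mul_inv_cancel₀ hs0.ne'] at h1
  exact h1.trans (le_add_of_nonneg_left (Real.exp_pos _).le)

/-! ### Sum and maximum of a finite sample -/

/-- The sum of the first `n` terms of `a`. -/
noncomputable def total (n : ℕ) (a : ℕ → ℝ) : ℝ := ∑ i ∈ Finset.range n, a i

/-- The maximum of the first `n` terms of `a`, or `0` if `n = 0`. -/
noncomputable def peak (n : ℕ) (a : ℕ → ℝ) : ℝ := ⨆ i : Fin n, a i

/-- The noise-plus-interference to signal ratio `(I + W - M) / M`, the inverse of the SINR. It takes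
the junk value `0` if `M = 0`. -/
noncomputable def nisr (W : ℝ) (n : ℕ) (a : ℕ → ℝ) : ℝ := (total n a + W - peak n a) / peak n a

theorem le_peak {n : ℕ} (a : ℕ → ℝ) {i : ℕ} (hi : i < n) : a i ≤ peak n a :=
  le_ciSup (f := fun j : Fin n => a j) (Set.finite_range _).bddAbove ⟨i, hi⟩

theorem peak_nonneg {n : ℕ} {a : ℕ → ℝ} (ha : ∀ i, i < n → 0 ≤ a i) : 0 ≤ peak n a :=
  Real.iSup_nonneg fun i => ha i i.2

theorem peak_le_iff {n : ℕ} {a : ℕ → ℝ} {x : ℝ} (hx : 0 ≤ x) :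
    peak n a ≤ x ↔ ∀ i, i < n → a i ≤ x :=
  ⟨fun h _ hi => (le_peak a hi).trans h, fun h => Real.iSup_le (fun i => h i i.2) hx⟩

theorem peak_le_total {n : ℕ} {a : ℕ → ℝ} (ha : ∀ i, i < n → 0 ≤ a i) :
    peak n a ≤ total n a := by
  have h0 : ∀ i ∈ Finset.range n, 0 ≤ a i := fun i hi => ha i (Finset.mem_range.1 hi)
  exact (peak_le_iff (Finset.sum_nonneg h0)).2 fun i hi =>
    Finset.single_le_sum h0 (Finset.mem_range.2 hi)

theorem nisr_nonneg {W : ℝ} (hW : 0 ≤ W) {n : ℕ} {a : ℕ → ℝ} (ha : ∀ i, i < n → 0 ≤ a i) :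
    0 ≤ nisr W n a :=
  div_nonneg (by linarith [peak_le_total ha]) (peak_nonneg ha)

/-- Over the sample, the factors `cutExp` multiply to `e^{-s I / b} 1(M ≤ x)`. -/
theorem prod_cutExp {n : ℕ} {a : ℕ → ℝ} (ha : ∀ i, i < n → 0 ≤ a i) (s b : ℝ) {x : ℝ}
    (hx : 0 ≤ x) : ∏ i ∈ Finset.range n, cutExp s b x (a i)
      = if peak n a ≤ x then Real.exp (-(s * total n a / b)) else 0 := by
  split_ifs with h
  · rw [total, Finset.mul_sum, Finset.sum_div, ← Finset.sum_neg_distrib, Real.exp_sum]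
    refine Finset.prod_congr rfl fun i hi => ?_
    have hi := Finset.mem_range.1 hi
    rw [cutExp, if_pos ((peak_le_iff hx).1 h i hi), max_eq_left (ha i hi)]
  · rw [peak_le_iff hx] at h
    push Not at h
    obtain ⟨i, hi, hlt⟩ := h
    exact Finset.prod_eq_zero (Finset.mem_range.2 hi) (if_neg hlt.not_ge)

section Measurability

variable {Ω : Type*} [MeasurableSpace Ω] {N : Ω → ℕ} {p : ℕ → Ω → ℝ}

theorem measurable_total (hN : Measurable N) (hp : ∀ i, Measurable (p i)) :
    Measurable fun ω => total (N ω) fun i => p i ω := by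
  have : Measurable fun q : Ω × ℕ => total q.2 fun i => p i q.1 :=
    measurable_from_prod_countable_left fun n =>
      Finset.measurable_fun_sum (Finset.range n) fun i _ => hp i
  exact this.comp (measurable_id.prodMk hN)

theorem measurable_peak (hN : Measurable N) (hp : ∀ i, Measurable (p i)) :
    Measurable fun ω => peak (N ω) fun i => p i ω := by
  have : Measurable fun q : Ω × ℕ => peak q.2 fun i => p i q.1 :=
    measurable_from_prod_countable_left fun n =>
      Measurable.iSup (ι := Fin n) (f := fun i ω => p i ω) fun i => hp i
  exact this.comp (measurable_id.prodMk hN)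

theorem measurable_nisr (W : ℝ) (hN : Measurable N) (hp : ∀ i, Measurable (p i)) :
    Measurable fun ω => nisr W (N ω) fun i => p i ω :=
  (((measurable_total hN hp).add_const W).sub (measurable_peak hN hp)).div (measurable_peak hN hp)

end Measurability

section Window

variable {F : Measure ℝ} [IsProbabilityMeasure F] {s c a b : ℝ}

theorem integral_cutExp_sub (hs : 0 ≤ s) (hc : 0 < c) :
    ∫ y, (1 - cutExp s c a y) ∂F - ∫ y, (1 - cutExp s c b y) ∂F
      = ∫ y, (cutExp s c b y - cutExp s c a y) ∂F := by
  rw [← integral_sub (integrable_one_sub_cutExp hs hc.le a) (integrable_one_sub_cutExp hs hc.le b)]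
  congr 1; ext y; ring

theorem cutExp_sub (hab : a ≤ b) (y : ℝ) : cutExp s c b y - cutExp s c a y
    = (Ioc a b).indicator (fun y => Real.exp (-(s * max y 0 / c))) y := by
  unfold cutExp indicator
  by_cases h1 : y ≤ a
  · rw [if_pos h1, if_pos (h1.trans hab), if_neg (fun h => h.1.not_ge h1), sub_self]
  · by_cases h2 : y ≤ b
    · rw [if_pos h2, if_neg h1, if_pos ⟨not_le.1 h1, h2⟩, sub_zero]
    · rw [if_neg h1, if_neg h2, if_neg (fun h => h2 h.2), sub_zero]

theorem integrable_cutExp_sub (hs : 0 ≤ s) (hc : 0 < c) :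
    Integrable (fun y => cutExp s c b y - cutExp s c a y) F := by
  have := (integrable_one_sub_cutExp (F := F) hs hc.le a).sub
    (integrable_one_sub_cutExp (F := F) hs hc.le b)
  refine this.congr (ae_of_all _ fun y => ?_)
  simp

theorem integral_cutExp_sub_le (hs : 0 ≤ s) (hc : 0 < c) (ha : 0 ≤ a) (hab : a ≤ b) :
    ∫ y, (1 - cutExp s c a y) ∂F - ∫ y, (1 - cutExp s c b y) ∂F
      ≤ Real.exp (-(s * a / c)) * (tail F a - tail F b) := by
  rw [integral_cutExp_sub hs hc, tail_sub_tail hab, mul_comm, ← smul_eq_mul,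
    ← integral_indicator_const _ measurableSet_Ioc]
  refine integral_mono (integrable_cutExp_sub hs hc)
    ((integrable_const _).indicator measurableSet_Ioc) fun y => ?_
  simp only [cutExp_sub hab]
  by_cases hy : y ∈ Ioc a b
  · rw [indicator_of_mem hy, indicator_of_mem hy, max_eq_left (ha.trans hy.1.le)]
    have := hy.1
    gcongr
  · rw [indicator_of_notMem hy, indicator_of_notMem hy]

theorem le_integral_cutExp_sub (hs : 0 ≤ s) (hc : 0 < c) (ha : 0 ≤ a) (hab : a ≤ b) :
    Real.exp (-(s * b / c)) * (tail F a - tail F b) ≤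
      ∫ y, (1 - cutExp s c a y) ∂F - ∫ y, (1 - cutExp s c b y) ∂F := by
  rw [integral_cutExp_sub hs hc, tail_sub_tail hab, mul_comm, ← smul_eq_mul,
    ← integral_indicator_const _ measurableSet_Ioc]
  refine integral_mono ((integrable_const _).indicator measurableSet_Ioc)
    (integrable_cutExp_sub hs hc) fun y => ?_
  simp only [cutExp_sub hab]
  by_cases hy : y ∈ Ioc a b
  · rw [indicator_of_mem hy, indicator_of_mem hy, max_eq_left (ha.trans hy.1.le)]
    have := hy.2
    gcongr
  · rw [indicator_of_notMem hy, indicator_of_notMem hy]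

end Window

theorem exp_neg_sub_exp_neg_le {x y : ℝ} :
    Real.exp (-y) - Real.exp (-x) ≤ Real.exp (-y) * (x - y) := by
  have h := Real.add_one_le_exp (-(x - y))
  have h2 : Real.exp (-x) = Real.exp (-y) * Real.exp (-(x - y)) := by
    rw [← Real.exp_add]; congr 1; ring
  rw [h2]
  nlinarith [Real.exp_pos (-y)]

theorem exp_neg_mul_sub_le {x y : ℝ} :
    Real.exp (-x) * (x - y) ≤ Real.exp (-y) - Real.exp (-x) := by
  have := exp_neg_sub_exp_neg_le (x := y) (y := x)
  linarith

/-! ### Laplace transform of the noise-plus-interference to signal ratio -/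

section Pointwise

variable {s W x₀ x y : ℝ} {n : ℕ} {a : ℕ → ℝ}

/-- On `x < M ≤ y`, the factor `e^{-s (I + W) / M}` is at most `e^{-s I / y}`. -/
theorem exp_nisr_mul_le (hs : 0 ≤ s) (hW : 0 ≤ W) (ha : ∀ i, i < n → 0 ≤ a i) (hx : 0 < x)
    (hxy : x ≤ y) :
    Real.exp (-(s * nisr W n a)) * ((if peak n a ≤ y then 1 else 0) - if peak n a ≤ x then 1 else 0)
      ≤ Real.exp s * (∏ i ∈ Finset.range n, cutExp s y y (a i)
        - ∏ i ∈ Finset.range n, cutExp s y x (a i)) := by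
  rw [prod_cutExp ha s y (hx.le.trans hxy), prod_cutExp ha s y hx.le]
  have ht : 0 ≤ total n a := (peak_nonneg ha).trans (peak_le_total ha)
  rcases le_or_gt (peak n a) x with h1 | h1
  · simp [h1, h1.trans hxy]
  rcases le_or_gt (peak n a) y with h2 | h2
  · have hm : 0 < peak n a := hx.trans h1
    rw [if_pos h2, if_neg h1.not_ge, if_pos h2, if_neg h1.not_ge, sub_zero, sub_zero, mul_one,
      ← Real.exp_add, Real.exp_le_exp, nisr, mul_div_assoc]
    have h3 : total n a / y ≤ (total n a + W) / peak n a :=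
      div_le_div₀ (by linarith) (by linarith) hm h2
    rw [sub_div, div_self hm.ne']
    nlinarith
  · simp [h1.not_ge, h2.not_ge]

/-- On `x < M ≤ y`, the factor `e^{-s I / M}` is at least `e^{-s I / x}`, and the noise costs at
most a factor `e^{-s W / x₀}`. -/
theorem le_exp_nisr_mul (hs : 0 ≤ s) (hW : 0 ≤ W) (ha : ∀ i, i < n → 0 ≤ a i) (hx₀ : 0 < x₀)
    (hx : x₀ ≤ x) (hxy : x ≤ y) :
    Real.exp (s - s * W / x₀) * (∏ i ∈ Finset.range n, cutExp s x y (a i)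
        - ∏ i ∈ Finset.range n, cutExp s x x (a i)) ≤
      Real.exp (-(s * nisr W n a)) *
        ((if peak n a ≤ y then 1 else 0) - if peak n a ≤ x then 1 else 0) := by
  have hx0 := hx₀.trans_le hx
  rw [prod_cutExp ha s x (hx0.le.trans hxy), prod_cutExp ha s x hx0.le]
  have ht : 0 ≤ total n a := (peak_nonneg ha).trans (peak_le_total ha)
  rcases le_or_gt (peak n a) x with h1 | h1
  · simp [h1, h1.trans hxy]
  rcases le_or_gt (peak n a) y with h2 | h2
  · have hm : 0 < peak n a := hx0.trans h1
    rw [if_pos h2, if_neg h1.not_ge, if_pos h2, if_neg h1.not_ge, sub_zero, sub_zero, mul_one,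
      ← Real.exp_add, Real.exp_le_exp, nisr, mul_div_assoc, mul_div_assoc]
    have h3 : total n a / peak n a ≤ total n a / x := div_le_div_of_nonneg_left ht hx0 h1.le
    have h4 : W / peak n a ≤ W / x₀ :=
      div_le_div_of_nonneg_left hW hx₀ (hx.trans h1.le)
    rw [sub_div, div_self hm.ne', add_div]
    nlinarith
  · simp [h1.not_ge, h2.not_ge]

end Pointwise

namespace IsPoissonSample

variable {Ω : Type*} [MeasurableSpace Ω] {P : Measure Ω} [IsProbabilityMeasure P] {F : Measure ℝ}
  [IsProbabilityMeasure F] {μ : ℝ} {N : Ω → ℕ} {p : ℕ → Ω → ℝ}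

omit [IsProbabilityMeasure P] [IsProbabilityMeasure F] in
theorem integral_prod_cutExp (h : IsPoissonSample P F μ N p) {s b : ℝ} (hs : 0 ≤ s) (hb : 0 ≤ b)
    (a : ℝ) : ∫ ω, ∏ i ∈ Finset.range (N ω), cutExp s b a (p i ω) ∂P
      = Real.exp (-(μ * ∫ y, (1 - cutExp s b a y) ∂F)) :=
  h.integral_prod _ (measurable_cutExp s b a) (cutExp_nonneg s b a) (cutExp_le_one hs hb a)

omit [IsProbabilityMeasure F] in
theorem integrable_prod (h : IsPoissonSample P F μ N p) {g : ℝ → ℝ} (hg : Measurable g)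
    (h0 : ∀ y, 0 ≤ g y) (h1 : ∀ y, g y ≤ 1) :
    Integrable (fun ω => ∏ i ∈ Finset.range (N ω), g (p i ω)) P := by
  refine (integrable_const (1 : ℝ)).mono' (measurable_prod_range h.measurable_num
    fun i => hg.comp (h.measurable_point i)).aestronglyMeasurable (ae_of_all _ fun ω => ?_)
  rw [Real.norm_of_nonneg (Finset.prod_nonneg fun i _ => h0 _)]
  exact Finset.prod_le_one (fun i _ => h0 _) (fun i _ => h1 _)

omit [IsProbabilityMeasure F] in
theorem integrable_prod_cutExp (h : IsPoissonSample P F μ N p) {s b : ℝ} (hs : 0 ≤ s)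
    (hb : 0 ≤ b) (a : ℝ) :
    Integrable (fun ω => ∏ i ∈ Finset.range (N ω), cutExp s b a (p i ω)) P :=
  h.integrable_prod (measurable_cutExp s b a) (cutExp_nonneg s b a) (cutExp_le_one hs hb a)

omit [IsProbabilityMeasure P] in
theorem integral_peak_le (h : IsPoissonSample P F μ N p) {x : ℝ} (hx : 0 ≤ x) :
    ∫ ω, (if peak (N ω) (fun i => p i ω) ≤ x then (1 : ℝ) else 0) ∂P
      = Real.exp (-(μ * tail F x)) := by
  have h1 := h.integral_prod_cutExp le_rfl zero_le_one x
  have h2 : ∫ y, (1 - cutExp 0 1 x y) ∂F = tail F x := by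
    rw [tail_eq_real_Ioi, ← integral_indicator_one measurableSet_Ioi]
    congr 1; ext y
    by_cases hy : y ≤ x
    · simp [cutExp, hy]
    · simp [cutExp, hy, not_le.1 hy]
  rw [← h2, ← h1]
  refine integral_congr_ae ?_
  filter_upwards [h.nonneg] with ω hω
  rw [prod_cutExp (fun i _ => hω i) 0 1 hx]
  simp

omit [IsProbabilityMeasure F] in
theorem integrable_exp_nisr_mul (h : IsPoissonSample P F μ N p) {W s : ℝ} (hW : 0 ≤ W)
    (hs : 0 ≤ s) (x : ℝ) :
    Integrable (fun ω => Real.exp (-(s * nisr W (N ω) fun i => p i ω)) *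
      if peak (N ω) (fun i => p i ω) ≤ x then 1 else 0) P := by
  refine (integrable_const (1 : ℝ)).mono' (Measurable.aestronglyMeasurable ?_) ?_
  · refine Measurable.mul ?_ ?_
    · exact ((measurable_nisr W h.measurable_num h.measurable_point).const_mul s).neg.exp
    · exact Measurable.ite (measurableSet_le (measurable_peak h.measurable_num h.measurable_point)
        measurable_const) measurable_const measurable_const
  · filter_upwards [h.nonneg] with ω hω
    have h0 := nisr_nonneg hW (n := N ω) (fun i _ => hω i)
    rw [Real.norm_of_nonneg (by positivity)]
    refine mul_le_one₀ (Real.exp_le_one_iff.2 (by rw [neg_nonpos]; positivity)) (by positivity) ?_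
    split_ifs <;> norm_num

/-- The contribution of the window `x < M ≤ y` to the Laplace transform is bounded by a difference,
so that the bounds for successive windows telescope. -/
theorem integral_exp_nisr_step_le (h : IsPoissonSample P F μ N p) {W s x y c : ℝ} (hW : 0 ≤ W)
    (hs : 0 ≤ s) (hμ : 0 ≤ μ) (hx : 0 < x) (hxy : x ≤ y) (hc : 0 < c)
    (hJ : c * tail F x ≤ ∫ z, (1 - cutExp s y y z) ∂F) :
    ∫ ω, (Real.exp (-(s * nisr W (N ω) fun i => p i ω)) *
        if peak (N ω) (fun i => p i ω) ≤ y then 1 else 0) ∂P -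
      ∫ ω, (Real.exp (-(s * nisr W (N ω) fun i => p i ω)) *
        if peak (N ω) (fun i => p i ω) ≤ x then 1 else 0) ∂P ≤
    Real.exp (s - s * x / y) / c *
      (Real.exp (-(c * μ * tail F y)) - Real.exp (-(c * μ * tail F x))) := by
  have hy := hx.trans_le hxy
  set J := ∫ z, (1 - cutExp s y y z) ∂F with hJdef
  set J' := ∫ z, (1 - cutExp s y x z) ∂F with hJ'def
  have hT : J' - J ≤ Real.exp (-(s * x / y)) * (tail F x - tail F y) :=
    integral_cutExp_sub_le hs hy hx.le hxy
  have hΔ : 0 ≤ tail F x - tail F y := sub_nonneg.2 (antitone_tail hxy)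
  rw [← integral_sub (h.integrable_exp_nisr_mul hW hs y) (h.integrable_exp_nisr_mul hW hs x)]
  calc _ ≤ ∫ ω, Real.exp s * (∏ i ∈ Finset.range (N ω), cutExp s y y (p i ω)
        - ∏ i ∈ Finset.range (N ω), cutExp s y x (p i ω)) ∂P := by
        refine integral_mono_ae ((h.integrable_exp_nisr_mul hW hs y).sub
          (h.integrable_exp_nisr_mul hW hs x)) (((h.integrable_prod_cutExp hs hy.le y).sub
          (h.integrable_prod_cutExp hs hy.le x)).const_mul _) ?_
        filter_upwards [h.nonneg] with ω hω
        rw [← mul_sub]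
        exact exp_nisr_mul_le hs hW (fun i _ => hω i) hx hxy
    _ = Real.exp s * (Real.exp (-(μ * J)) - Real.exp (-(μ * J'))) := by
        rw [integral_const_mul, integral_sub (h.integrable_prod_cutExp hs hy.le y)
          (h.integrable_prod_cutExp hs hy.le x), h.integral_prod_cutExp hs hy.le,
          h.integral_prod_cutExp hs hy.le]
    _ ≤ Real.exp s * (Real.exp (-(μ * J)) * (μ * J' - μ * J)) := by
        gcongr
        exact exp_neg_sub_exp_neg_le
    _ ≤ Real.exp s * (Real.exp (-(c * μ * tail F x)) *
          (μ * (Real.exp (-(s * x / y)) * (tail F x - tail F y)))) := by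
        rw [← mul_sub]
        have h1 : Real.exp (-(μ * J)) ≤ Real.exp (-(c * μ * tail F x)) := by
          rw [Real.exp_le_exp, neg_le_neg_iff]
          nlinarith
        have h2 : μ * (J' - J) ≤ μ * (Real.exp (-(s * x / y)) * (tail F x - tail F y)) := by
          gcongr
        gcongr
        exact mul_nonneg hμ ((mul_nonneg (Real.exp_pos _).le hΔ).trans
          (le_integral_cutExp_sub hs hy hx.le hxy))
    _ = Real.exp (s - s * x / y) / c *
          (Real.exp (-(c * μ * tail F x)) * (c * μ * tail F x - c * μ * tail F y)) := by
        rw [sub_eq_add_neg s, Real.exp_add]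
        field_simp
    _ ≤ _ := by
        gcongr
        exact exp_neg_mul_sub_le

/-- The lower bound for the contribution of the window `x < M ≤ y`, again a difference that
telescopes. -/
theorem le_integral_exp_nisr_step (h : IsPoissonSample P F μ N p) {W s x₀ x y c : ℝ} (hW : 0 ≤ W)
    (hs : 0 ≤ s) (hμ : 0 ≤ μ) (hx₀ : 0 < x₀) (hx : x₀ ≤ x) (hxy : x ≤ y) (hc : 0 < c)
    (hJ : ∫ z, (1 - cutExp s x x z) ∂F ≤ c * tail F y) :
    Real.exp (s - s * W / x₀ - s * y / x) / c *
      (Real.exp (-(c * μ * tail F y)) - Real.exp (-(c * μ * tail F x))) ≤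
    ∫ ω, (Real.exp (-(s * nisr W (N ω) fun i => p i ω)) *
        if peak (N ω) (fun i => p i ω) ≤ y then 1 else 0) ∂P -
      ∫ ω, (Real.exp (-(s * nisr W (N ω) fun i => p i ω)) *
        if peak (N ω) (fun i => p i ω) ≤ x then 1 else 0) ∂P := by
  have hx0 := hx₀.trans_le hx
  set J := ∫ z, (1 - cutExp s x x z) ∂F with hJdef
  set J' := ∫ z, (1 - cutExp s x y z) ∂F with hJ'def
  have hT : Real.exp (-(s * y / x)) * (tail F x - tail F y) ≤ J - J' :=
    le_integral_cutExp_sub hs hx0 hx0.le hxy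
  have hΔ : 0 ≤ tail F x - tail F y := sub_nonneg.2 (antitone_tail hxy)
  rw [← integral_sub (h.integrable_exp_nisr_mul hW hs y) (h.integrable_exp_nisr_mul hW hs x)]
  calc Real.exp (s - s * W / x₀ - s * y / x) / c *
        (Real.exp (-(c * μ * tail F y)) - Real.exp (-(c * μ * tail F x)))
      ≤ Real.exp (s - s * W / x₀ - s * y / x) / c *
        (Real.exp (-(c * μ * tail F y)) * (c * μ * tail F x - c * μ * tail F y)) := by
        gcongr
        exact exp_neg_sub_exp_neg_le
    _ = Real.exp (s - s * W / x₀) * (Real.exp (-(c * μ * tail F y)) *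
          (μ * (Real.exp (-(s * y / x)) * (tail F x - tail F y)))) := by
        rw [sub_eq_add_neg _ (s * y / x), Real.exp_add]
        field_simp
    _ ≤ Real.exp (s - s * W / x₀) * (Real.exp (-(μ * J)) * (μ * J - μ * J')) := by
        rw [← mul_sub]
        have h1 : Real.exp (-(c * μ * tail F y)) ≤ Real.exp (-(μ * J)) := by
          rw [Real.exp_le_exp, neg_le_neg_iff]
          nlinarith
        gcongr
    _ ≤ Real.exp (s - s * W / x₀) * (Real.exp (-(μ * J')) - Real.exp (-(μ * J))) := by
        gcongr
        exact exp_neg_mul_sub_le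
    _ = ∫ ω, Real.exp (s - s * W / x₀) * (∏ i ∈ Finset.range (N ω), cutExp s x y (p i ω)
        - ∏ i ∈ Finset.range (N ω), cutExp s x x (p i ω)) ∂P := by
        rw [integral_const_mul, integral_sub (h.integrable_prod_cutExp hs hx0.le y)
          (h.integrable_prod_cutExp hs hx0.le x), h.integral_prod_cutExp hs hx0.le,
          h.integral_prod_cutExp hs hx0.le]
    _ ≤ _ := by
        refine integral_mono_ae (((h.integrable_prod_cutExp hs hx0.le y).sub
          (h.integrable_prod_cutExp hs hx0.le x)).const_mul _)
          ((h.integrable_exp_nisr_mul hW hs y).sub (h.integrable_exp_nisr_mul hW hs x)) ?_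
        filter_upwards [h.nonneg] with ω hω
        rw [← mul_sub]
        exact le_exp_nisr_mul hs hW (fun i _ => hω i) hx₀ hx hxy

omit [IsProbabilityMeasure F] in
theorem tendsto_integral_exp_nisr_mul (h : IsPoissonSample P F μ N p) {W s : ℝ} (hW : 0 ≤ W)
    (hs : 0 ≤ s) {u : ℕ → ℝ} (hu : Tendsto u atTop atTop) :
    Tendsto (fun n => ∫ ω, (Real.exp (-(s * nisr W (N ω) fun i => p i ω)) *
        if peak (N ω) (fun i => p i ω) ≤ u n then 1 else 0) ∂P) atTop
      (𝓝 (∫ ω, Real.exp (-(s * nisr W (N ω) fun i => p i ω)) ∂P)) := by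
  refine tendsto_integral_of_dominated_convergence (fun _ => 1)
    (fun n => (h.integrable_exp_nisr_mul hW hs _).aestronglyMeasurable) (integrable_const _)
    (fun n => ?_) ?_
  · filter_upwards [h.nonneg] with ω hω
    have h0 := nisr_nonneg hW (n := N ω) (fun i _ => hω i)
    rw [Real.norm_of_nonneg (by positivity)]
    refine mul_le_one₀ (Real.exp_le_one_iff.2 (by rw [neg_nonpos]; positivity)) (by positivity) ?_
    split_ifs <;> norm_num
  · refine ae_of_all _ fun ω => tendsto_const_nhds.congr' ?_
    filter_upwards [hu.eventually_ge_atTop (peak (N ω) fun i => p i ω)] with n hn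
    rw [if_pos hn, mul_one]

theorem integral_exp_nisr_le (h : IsPoissonSample P F μ N p) {W s x₀ q c : ℝ} (hW : 0 ≤ W)
    (hs : 0 ≤ s) (hμ : 0 ≤ μ) (hx₀ : 0 < x₀) (hq : 1 < q) (hc : 0 < c)
    (hJ : ∀ x, x₀ ≤ x → c * tail F x ≤ ∫ z, (1 - cutExp s (q * x) (q * x) z) ∂F) :
    ∫ ω, Real.exp (-(s * nisr W (N ω) fun i => p i ω)) ∂P ≤
      Real.exp (-(μ * tail F x₀)) + Real.exp (s - s / q) / c := by
  set D : ℝ → ℝ := fun x => ∫ ω, (Real.exp (-(s * nisr W (N ω) fun i => p i ω)) *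
        if peak (N ω) (fun i => p i ω) ≤ x then 1 else 0) ∂P with hD
  set C := Real.exp (s - s / q) / c with hC
  have hq0 : 0 < q := one_pos.trans hq
  have hu : Tendsto (fun n : ℕ => q ^ n * x₀) atTop atTop :=
    (tendsto_pow_atTop_atTop_of_one_lt hq).atTop_mul_const hx₀
  have hge : ∀ n : ℕ, x₀ ≤ q ^ n * x₀ := fun n => le_mul_of_one_le_left hx₀.le (one_le_pow₀ hq.le)
  have hstep : ∀ n : ℕ, D (q ^ n * x₀) - D x₀ ≤
      C * (Real.exp (-(c * μ * tail F (q ^ n * x₀))) - Real.exp (-(c * μ * tail F x₀))) := by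
    intro n
    induction n with
    | zero => simp
    | succ n ih =>
      have hn := hx₀.trans_le (hge n)
      have := h.integral_exp_nisr_step_le hW hs hμ hn (le_mul_of_one_le_left hn.le hq.le) hc
        (hJ _ (hge n))
      have he : s * (q ^ n * x₀) / (q * (q ^ n * x₀)) = s / q := by field_simp
      rw [he] at this
      rw [show q ^ (n + 1) * x₀ = q * (q ^ n * x₀) by ring]
      change D (q * (q ^ n * x₀)) - D (q ^ n * x₀) ≤ C * _ at this
      linarith
  have hlim := (h.tendsto_integral_exp_nisr_mul hW hs hu).sub_const (D x₀)
  have hle := le_of_tendsto hlim (b := C) (Eventually.of_forall fun n => (hstep n).trans (by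
    refine mul_le_of_le_one_right (by positivity) ?_
    have : Real.exp (-(c * μ * tail F (q ^ n * x₀))) ≤ 1 := by
      rw [Real.exp_le_one_iff, neg_nonpos]
      have := tail_nonneg (F := F) (q ^ n * x₀)
      positivity
    linarith [Real.exp_pos (-(c * μ * tail F x₀))]))
  have hD0 : D x₀ ≤ Real.exp (-(μ * tail F x₀)) := by
    rw [← h.integral_peak_le hx₀.le]
    refine integral_mono_ae (h.integrable_exp_nisr_mul hW hs x₀) ?_ ?_
    · simpa using h.integrable_exp_nisr_mul hW le_rfl x₀
    · filter_upwards [h.nonneg] with ω hω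
      have h0 := nisr_nonneg hW (n := N ω) (fun i _ => hω i)
      refine mul_le_of_le_one_left (by positivity) (Real.exp_le_one_iff.2 ?_)
      rw [neg_nonpos]; positivity
  linarith

theorem le_integral_exp_nisr (h : IsPoissonSample P F μ N p) {W s x₀ q c : ℝ} (hW : 0 ≤ W)
    (hs : 0 ≤ s) (hμ : 0 ≤ μ) (hx₀ : 0 < x₀) (hq : 1 < q) (hc : 0 < c)
    (hJ : ∀ x, x₀ ≤ x → ∫ z, (1 - cutExp s x x z) ∂F ≤ c * tail F (q * x)) :
    Real.exp (s - s * W / x₀ - s * q) / c * (1 - Real.exp (-(c * μ * tail F x₀))) ≤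
      ∫ ω, Real.exp (-(s * nisr W (N ω) fun i => p i ω)) ∂P := by
  set D : ℝ → ℝ := fun x => ∫ ω, (Real.exp (-(s * nisr W (N ω) fun i => p i ω)) *
        if peak (N ω) (fun i => p i ω) ≤ x then 1 else 0) ∂P with hD
  set C := Real.exp (s - s * W / x₀ - s * q) / c with hC
  have hq0 : 0 < q := one_pos.trans hq
  have hu : Tendsto (fun n : ℕ => q ^ n * x₀) atTop atTop :=
    (tendsto_pow_atTop_atTop_of_one_lt hq).atTop_mul_const hx₀
  have hge : ∀ n : ℕ, x₀ ≤ q ^ n * x₀ := fun n => le_mul_of_one_le_left hx₀.le (one_le_pow₀ hq.le)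
  have hstep : ∀ n : ℕ,
      C * (Real.exp (-(c * μ * tail F (q ^ n * x₀))) - Real.exp (-(c * μ * tail F x₀))) ≤
        D (q ^ n * x₀) - D x₀ := by
    intro n
    induction n with
    | zero => simp
    | succ n ih =>
      have hn := hx₀.trans_le (hge n)
      have := h.le_integral_exp_nisr_step hW hs hμ hx₀ (hge n)
        (le_mul_of_one_le_left hn.le hq.le) hc (hJ _ (hge n))
      have he : s * (q * (q ^ n * x₀)) / (q ^ n * x₀) = s * q := by field_simp
      rw [he] at this
      rw [show q ^ (n + 1) * x₀ = q * (q ^ n * x₀) by ring]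
      change C * _ ≤ D (q * (q ^ n * x₀)) - D (q ^ n * x₀) at this
      linarith
  have hlim := (h.tendsto_integral_exp_nisr_mul hW hs hu).sub_const (D x₀)
  have hlim' : Tendsto (fun n : ℕ => C * (Real.exp (-(c * μ * tail F (q ^ n * x₀))) -
      Real.exp (-(c * μ * tail F x₀)))) atTop (𝓝 (C * (1 - Real.exp (-(c * μ * tail F x₀))))) := by
    have := (((tendsto_tail_atTop (F := F)).comp hu).const_mul (c * μ)).neg.rexp
    simp only [mul_zero, neg_zero, Real.exp_zero] at this
    exact (this.sub_const _).const_mul _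
  have hle := le_of_tendsto_of_tendsto' hlim' hlim hstep
  have hD0 : 0 ≤ D x₀ := integral_nonneg fun ω => by positivity
  linarith

end IsPoissonSample

/-- The Laplace transform of `(I + W - M) / M` converges as the intensity grows. -/
theorem tendsto_integral_exp_nisr {ι Ω : Type*} {l : Filter ι} [MeasurableSpace Ω] {P : Measure Ω}
    [IsProbabilityMeasure P] {F : Measure ℝ} [IsProbabilityMeasure F] {μ : ι → ℝ}
    {N : ι → Ω → ℕ} {p : ι → ℕ → Ω → ℝ} (h : ∀ i, IsPoissonSample P F (μ i) (N i) (p i))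
    (hμ : Tendsto μ l atTop) {α W s : ℝ} (hF : IsRegularlyVarying (tail F) (-α)) (hα0 : 0 ≤ α)
    (hα1 : α < 1) (hW : 0 ≤ W) (hs : 0 ≤ s) :
    Tendsto (fun i => ∫ ω, Real.exp (-(s * nisr W (N i ω) fun j => p i j ω)) ∂P) l
      (𝓝 (limitExponent α s)⁻¹) := by
  set φ := limitExponent α s with hφdef
  have hφ : 0 < φ := limitExponent_pos hs
  have hJ : Tendsto (fun b => (∫ y, (1 - cutExp s b b y) ∂F) / tail F b) atTop (𝓝 φ) :=
    hF.tendsto_integral_one_sub_cutExp_div hα0 hα1 hs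
  have hexp : ∀ c x₀, 0 < c → 0 < x₀ →
      Tendsto (fun i => Real.exp (-(c * μ i * tail F x₀))) l (𝓝 0) := fun c x₀ hc hx₀ => by
    refine Real.tendsto_exp_neg_atTop_nhds_zero.comp ?_
    exact (hμ.const_mul_atTop hc).atTop_mul_const (hF.pos x₀ hx₀)
  rw [tendsto_order]
  constructor
  · intro A hA
    obtain ⟨B, hAB, hB⟩ := exists_between (max_lt hA (inv_pos.2 hφ))
    have hB0 : 0 < B := (le_max_right _ _).trans_lt hAB
    have hAB : A < B := (le_max_left _ _).trans_lt hAB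
    -- choose `q` close to `1`, and then `c` with `e^{s - s q} / c > B` and `c > φ q ^ α`
    have hcont : Tendsto (fun q : ℝ => Real.exp (s - s * q) / B - φ * q ^ α) (𝓝[>] 1)
        (𝓝 (B⁻¹ - φ)) := by
      have : ContinuousAt (fun q : ℝ => Real.exp (s - s * q) / B - φ * q ^ α) 1 := by
        refine ContinuousAt.sub (by fun_prop) (continuousAt_const.mul ?_)
        exact Real.continuousAt_rpow_const _ _ (Or.inl one_ne_zero)
      have h1 := this.tendsto
      simp only [mul_one, sub_self, Real.exp_zero, Real.one_rpow, one_div] at h1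
      exact h1.mono_left nhdsWithin_le_nhds
    have hpos : 0 < B⁻¹ - φ := sub_pos.2 ((lt_inv_comm₀ hφ hB0).2 hB)
    obtain ⟨q, hqpos, hq⟩ := ((hcont.eventually_const_lt hpos).and self_mem_nhdsWithin).exists
    have hq : 1 < q := hq
    have hq0 : 0 < q := one_pos.trans hq
    obtain ⟨c, hc1, hc2⟩ := exists_between (sub_pos.1 hqpos)
    have hc0 : 0 < c := lt_trans (by positivity) hc1
    have hratio : Tendsto (fun x => (∫ y, (1 - cutExp s x x y) ∂F) / tail F (q * x)) atTop
        (𝓝 (φ * q ^ α)) := by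
      have h2 := (hF.lim q hq0).inv₀ (by positivity)
      rw [Real.rpow_neg hq0.le, inv_inv] at h2
      refine (hJ.mul h2).congr' ?_
      filter_upwards [eventually_gt_atTop 0] with x hx
      have := hF.pos x hx
      have := hF.pos (q * x) (by positivity)
      field_simp
    obtain ⟨x₁, hx₁⟩ := eventually_atTop.1 (hratio.eventually_lt_const hc1)
    have hBc : B < Real.exp (s - s * q) / c := by
      rw [lt_div_iff₀ hB0] at hc2
      rwa [lt_div_iff₀ hc0, mul_comm]
    have hlimx : Tendsto (fun x => Real.exp (s - s * W / x - s * q) / c) atTop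
        (𝓝 (Real.exp (s - s * q) / c)) := by
      have h1 : Tendsto (fun x : ℝ => s * W / x) atTop (𝓝 0) :=
        tendsto_const_nhds.div_atTop tendsto_id
      have h2 := (((h1.const_sub s).sub_const (s * q)).rexp).div_const c
      simpa using h2
    obtain ⟨x₀, ⟨hx₀B, hx₀1⟩, hx₀⟩ := (((hlimx.eventually_const_lt hBc).and
      (eventually_ge_atTop x₁)).and (eventually_gt_atTop 0)).exists
    have hfin : Tendsto (fun i => Real.exp (s - s * W / x₀ - s * q) / c *
        (1 - Real.exp (-(c * μ i * tail F x₀)))) l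
        (𝓝 (Real.exp (s - s * W / x₀ - s * q) / c * (1 - 0))) :=
      ((hexp c x₀ hc0 hx₀).const_sub 1).const_mul _
    rw [sub_zero, mul_one] at hfin
    filter_upwards [hfin.eventually_const_lt hx₀B, hμ.eventually_ge_atTop 0] with i hi hμi
    refine (hAB.trans hi).trans_le ((h i).le_integral_exp_nisr hW hs hμi hx₀ hq hc0 fun x hx => ?_)
    have := hx₁ x (hx₀1.trans hx)
    rw [div_lt_iff₀ (hF.pos _ (mul_pos hq0 (hx₀.trans_le hx)))] at this
    exact this.le
  · intro B hB
    have hB0 : 0 < B := (inv_pos.2 hφ).trans hB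
    -- choose `q` close to `1`, and then `c` with `e^{s - s / q} / c < B` and `c < φ q ^ (-α)`
    have hcont : Tendsto (fun q : ℝ => φ * q ^ (-α) - Real.exp (s - s / q) / B) (𝓝[>] 1)
        (𝓝 (φ - B⁻¹)) := by
      have : ContinuousAt (fun q : ℝ => φ * q ^ (-α) - Real.exp (s - s / q) / B) 1 := by
        refine ContinuousAt.sub (continuousAt_const.mul ?_) ?_
        · exact Real.continuousAt_rpow_const _ _ (Or.inl one_ne_zero)
        · refine ContinuousAt.div_const (ContinuousAt.rexp ?_) _
          exact continuousAt_const.sub (continuousAt_const.div continuousAt_id one_ne_zero)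
      have h1 := this.tendsto
      simp only [div_one, mul_one, sub_self, Real.exp_zero, Real.one_rpow, one_div] at h1
      exact h1.mono_left nhdsWithin_le_nhds
    have hpos : 0 < φ - B⁻¹ := sub_pos.2 ((inv_lt_comm₀ hφ hB0).1 hB)
    obtain ⟨q, hqpos, hq⟩ := ((hcont.eventually_const_lt hpos).and self_mem_nhdsWithin).exists
    have hq : 1 < q := hq
    have hq0 : 0 < q := one_pos.trans hq
    obtain ⟨c, hc1, hc2⟩ := exists_between (sub_pos.1 hqpos)
    have hc0 : 0 < c := lt_trans (by positivity) hc1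
    have hratio : Tendsto (fun x => (∫ y, (1 - cutExp s (q * x) (q * x) y) ∂F) / tail F x) atTop
        (𝓝 (φ * q ^ (-α))) := by
      have h2 := (hJ.comp (tendsto_id.const_mul_atTop hq0)).mul (hF.lim q hq0)
      refine h2.congr' ?_
      filter_upwards [eventually_gt_atTop 0] with x hx
      have := hF.pos x hx
      have := hF.pos (q * x) (by positivity)
      simp only [Function.comp_apply, id]
      field_simp
    obtain ⟨x₁, hx₁⟩ := eventually_atTop.1 (hratio.eventually_const_lt hc2)
    have hBc : Real.exp (s - s / q) / c < B := by
      rw [div_lt_iff₀ hB0] at hc1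
      rwa [div_lt_iff₀ hc0, mul_comm]
    set x₀ := max x₁ 1 with hx₀def
    have hx₀ : 0 < x₀ := one_pos.trans_le (le_max_right _ _)
    have hfin := (hexp 1 x₀ one_pos hx₀).add_const (Real.exp (s - s / q) / c)
    rw [zero_add] at hfin
    filter_upwards [hfin.eventually_lt_const hBc, hμ.eventually_ge_atTop 0] with i hi hμi
    rw [one_mul] at hi
    refine ((h i).integral_exp_nisr_le hW hs hμi hx₀ hq hc0 fun x hx => ?_).trans_lt hi
    have := hx₁ x ((le_max_left _ _).trans hx)
    rw [lt_div_iff₀ (hF.pos _ (hx₀.trans_le hx))] at this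
    exact this.le

/-! ### Heavy tails: convergence in probability and in distribution -/

/-- If the ratio vanishes, then at most one point is positive; the product of halves has mean
exponentially small in the intensity, and so bounds the probability of this junk event. -/
theorem half_le_prod_of_nisr_eq_zero {W : ℝ} (hW : 0 ≤ W) {n : ℕ} {a : ℕ → ℝ}
    (ha : ∀ i, i < n → 0 ≤ a i) (h : nisr W n a = 0) :
    (1 / 2 : ℝ) ≤ ∏ i ∈ Finset.range n, if 0 < a i then 1 / 2 else 1 := by
  have hmt := peak_le_total ha
  -- all the terms vanish, except possibly a maximal one
  obtain ⟨j, hj⟩ : ∃ j, ∀ i, i < n → i ≠ j → a i = 0 := by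
    rcases Nat.eq_zero_or_pos n with rfl | hn
    · exact ⟨0, fun i hi => absurd hi (by omega)⟩
    have : Nonempty (Fin n) := ⟨⟨0, hn⟩⟩
    obtain ⟨j, hj⟩ := exists_eq_ciSup_of_finite (f := fun i : Fin n => a i)
    have hj : a j = peak n a := hj
    refine ⟨j, fun i hi hij => le_antisymm ?_ (ha i hi)⟩
    rcases div_eq_zero_iff.1 h with h0 | h0
    · have h2 : a i + a j ≤ total n a := by
        rw [total, ← Finset.sum_pair hij]
        refine Finset.sum_le_sum_of_subset_of_nonneg (fun k hk => ?_)
          fun k hk _ => ha k (Finset.mem_range.1 hk)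
        rcases Finset.mem_insert.1 hk with rfl | hk
        · exact Finset.mem_range.2 hi
        · rw [Finset.mem_singleton.1 hk]; exact Finset.mem_range.2 j.2
      linarith
    · exact (le_peak a hi).trans h0.le
  by_cases hjn : j < n
  · rw [Finset.prod_eq_single_of_mem j (Finset.mem_range.2 hjn) fun i hi hij => by
      rw [hj i (Finset.mem_range.1 hi) hij, if_neg (lt_irrefl _)]]
    split_ifs <;> norm_num
  · rw [Finset.prod_eq_one fun i hi => by
      have hi := Finset.mem_range.1 hi
      rw [hj i hi (by rintro rfl; exact hjn hi), if_neg (lt_irrefl _)]]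
    norm_num

theorem IsPoissonSample.integral_prod_half {Ω : Type*} [MeasurableSpace Ω] {P : Measure Ω}
    {F : Measure ℝ} [IsProbabilityMeasure F] {μ : ℝ} {N : Ω → ℕ} {p : ℕ → Ω → ℝ}
    (h : IsPoissonSample P F μ N p) :
    ∫ ω, ∏ i ∈ Finset.range (N ω), (if 0 < p i ω then (1 / 2 : ℝ) else 1) ∂P
      = Real.exp (-(μ * (tail F 0 / 2))) := by
  rw [h.integral_prod (fun y => if 0 < y then 1 / 2 else 1)
    (Measurable.ite measurableSet_Ioi measurable_const measurable_const)
    (fun y => by split_ifs <;> norm_num) (fun y => by split_ifs <;> norm_num)]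
  congr 3
  rw [tail_eq_real_Ioi, ← integral_indicator_one measurableSet_Ioi, ← integral_div]
  congr 1; ext y
  by_cases hy : 0 < y
  · simp [hy]; norm_num
  · simp [hy]

section Asymptotics

variable {ι Ω : Type*} {l : Filter ι} [MeasurableSpace Ω] {P : Measure Ω}
  [IsProbabilityMeasure P] {F : Measure ℝ} [IsProbabilityMeasure F] {μ : ι → ℝ}
  {N : ι → Ω → ℕ} {p : ι → ℕ → Ω → ℝ}

/-- For a slowly varying tail the Laplace transform of `X` tends to `1`, so that `X` tends to `0` in
probability. The event `X = 0`, where the inverse is junk, is negligible. -/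
theorem tendsto_measure_lt_inv_nisr (h : ∀ i, IsPoissonSample P F (μ i) (N i) (p i))
    (hμ : Tendsto μ l atTop) (hF : IsSlowlyVarying (tail F)) (hF0 : 0 < tail F 0) {W : ℝ}
    (hW : 0 ≤ W) (y : ℝ) :
    Tendsto (fun i => P {ω | y < (nisr W (N i ω) fun j => p i j ω)⁻¹}) l (𝓝 1) := by
  set r := (max y 1)⁻¹ with hr
  have hr0 : 0 < r := inv_pos.2 (one_pos.trans_le (le_max_right _ _))
  have hκ : 0 < 1 - Real.exp (-r) := by
    rw [sub_pos, Real.exp_lt_one_iff]; linarith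
  have hmeas : ∀ i, MeasurableSet {ω | y < (nisr W (N i ω) fun j => p i j ω)⁻¹} := fun i =>
    measurableSet_lt measurable_const
      (measurable_nisr W (h i).measurable_num (h i).measurable_point).inv
  have hlap := tendsto_integral_exp_nisr h hμ (α := 0) (by rw [neg_zero]; exact hF) le_rfl
    one_pos hW zero_le_one
  rw [limitExponent_zero_left, inv_one] at hlap
  simp only [one_mul] at hlap
  have hhalf : Tendsto (fun i => 2 * Real.exp (-(μ i * (tail F 0 / 2)))) l (𝓝 0) := by
    have : Tendsto (fun i => μ i * (tail F 0 / 2)) l atTop := hμ.atTop_mul_const (by positivity)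
    simpa using (Real.tendsto_exp_neg_atTop_nhds_zero.comp this).const_mul 2
  have hbad : ∀ i, P.real {ω | y < (nisr W (N i ω) fun j => p i j ω)⁻¹}ᶜ ≤
      2 * Real.exp (-(μ i * (tail F 0 / 2))) +
      (1 - ∫ ω, Real.exp (-(nisr W (N i ω) fun j => p i j ω)) ∂P) / (1 - Real.exp (-r)) := by
    intro i
    have hintX : Integrable (fun ω => Real.exp (-(nisr W (N i ω) fun j => p i j ω))) P := by
      refine (integrable_const (1 : ℝ)).mono' (measurable_nisr W (h i).measurable_num
        (h i).measurable_point).neg.exp.aestronglyMeasurable ?_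
      filter_upwards [(h i).nonneg] with ω hω
      rw [Real.norm_of_nonneg (Real.exp_pos _).le, Real.exp_le_one_iff, neg_nonpos]
      exact nisr_nonneg hW fun j _ => hω j
    have hintprod := (h i).integrable_prod (g := fun y => if 0 < y then 1 / 2 else 1)
      (Measurable.ite measurableSet_Ioi measurable_const measurable_const)
      (fun y => by split_ifs <;> norm_num) (fun y => by split_ifs <;> norm_num)
    rw [← (h i).integral_prod_half, ← integral_const_mul, ← integral_indicator_one (hmeas i).compl]
    have hone : (1 : ℝ) = ∫ _, (1 : ℝ) ∂P := by simp
    nth_rewrite 3 [hone]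
    have hint2 : Integrable (fun ω => (1 - Real.exp (-(nisr W (N i ω) fun j => p i j ω))) /
        (1 - Real.exp (-r))) P := ((integrable_const 1).sub hintX).div_const _
    rw [← integral_sub (integrable_const _) hintX, ← integral_div,
      ← integral_add (hintprod.const_mul 2) hint2]
    refine integral_mono_ae ((integrable_const (1 : ℝ)).indicator (hmeas i).compl)
      ((hintprod.const_mul 2).add hint2) ?_
    filter_upwards [(h i).nonneg] with ω hω
    have hX := nisr_nonneg hW (n := N i ω) (a := fun j => p i j ω) fun j _ => hω j
    set X := nisr W (N i ω) fun j => p i j ω with hXdef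
    have hp0 : 0 ≤ ∏ j ∈ Finset.range (N i ω), (if 0 < p i j ω then (1 / 2 : ℝ) else 1) :=
      Finset.prod_nonneg fun j _ => by split_ifs <;> norm_num
    have hq0 : 0 ≤ (1 - Real.exp (-X)) / (1 - Real.exp (-r)) :=
      div_nonneg (sub_nonneg.2 (Real.exp_le_one_iff.2 (by linarith))) hκ.le
    by_cases hbad : ω ∈ {ω | y < (nisr W (N i ω) fun j => p i j ω)⁻¹}ᶜ
    · rw [indicator_of_mem hbad, Pi.one_apply]
      rcases hX.eq_or_lt with h0 | hpos
      · have := half_le_prod_of_nisr_eq_zero hW (fun j _ => hω j) h0.symm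
        linarith
      · have hb : ¬ y < X⁻¹ := hbad
        have hle : X⁻¹ ≤ max y 1 := (not_lt.1 hb).trans (le_max_left _ _)
        have hrX : r ≤ X := inv_le_of_inv_le₀ hpos hle
        have : 1 ≤ (1 - Real.exp (-X)) / (1 - Real.exp (-r)) := by
          rw [one_le_div hκ]
          have := Real.exp_le_exp.2 (neg_le_neg hrX)
          linarith
        linarith
    · rw [indicator_of_notMem hbad]
      linarith
  have hlim : Tendsto (fun i => P.real {ω | y < (nisr W (N i ω) fun j => p i j ω)⁻¹}) l (𝓝 1) := by
    have hb := (hhalf.add ((hlap.const_sub 1).div_const (1 - Real.exp (-r)))).const_sub 1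
    simp only [sub_self, zero_div, add_zero, sub_zero] at hb
    refine tendsto_of_tendsto_of_tendsto_of_le_of_le hb tendsto_const_nhds (fun i => ?_)
      fun i => measureReal_le_one
    have := hbad i
    rw [probReal_compl_eq_one_sub (hmeas i)] at this
    simp only
    linarith
  have := ENNReal.tendsto_ofReal hlim
  simpa [measureReal_def] using this

end Asymptotics

open unitInterval in
/-- A law on `[0, 1]` is determined by its moments. -/
theorem probabilityMeasure_eq_of_moments_eq {ν ν' : ProbabilityMeasure I}
    (h : ∀ k : ℕ, ∫ x, (x : ℝ) ^ k ∂(ν : Measure I) = ∫ x, (x : ℝ) ^ k ∂(ν' : Measure I)) :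
    ν = ν' := by
  have hint : ∀ (f : C(I, ℝ)) (ν : ProbabilityMeasure I), Integrable f (ν : Measure I) := fun f ν =>
    (BoundedContinuousFunction.mkOfCompact f).integrable (ν : Measure I)
  -- the continuous functions with the same integral form a closed subspace
  have hcont : ∀ ν : ProbabilityMeasure I,
      Continuous fun f : C(I, ℝ) => ∫ x, f x ∂(ν : Measure I) := by
    intro ν
    refine (LipschitzWith.of_dist_le_mul (K := 1) fun f g => ?_).continuous
    rw [Real.dist_eq, ← integral_sub (hint f ν) (hint g ν), NNReal.coe_one, one_mul]
    have hle : ∀ x, ‖f x - g x‖ ≤ dist f g := fun x => by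
      rw [← dist_eq_norm]; exact ContinuousMap.dist_apply_le_dist x
    simpa using norm_integral_le_of_norm_le_const (ae_of_all (ν : Measure I) hle)
  have hclosed : IsClosed {f : C(I, ℝ) | ∫ x, f x ∂(ν : Measure I) = ∫ x, f x ∂(ν' : Measure I)} :=
    isClosed_eq (hcont ν) (hcont ν')
  have hpoly : ((polynomialFunctions I : Subalgebra ℝ C(I, ℝ)) : Set C(I, ℝ)) ⊆
      {f : C(I, ℝ) | ∫ x, f x ∂(ν : Measure I) = ∫ x, f x ∂(ν' : Measure I)} := by
    rintro f hf
    rw [polynomialFunctions_coe] at hf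
    obtain ⟨q, rfl⟩ := hf
    have hmon : ∀ (ν : ProbabilityMeasure I) (k : ℕ),
        Integrable (fun x : I => q.coeff k * (x : ℝ) ^ k) (ν : Measure I) := fun ν k =>
      hint ⟨fun x : I => q.coeff k * (x : ℝ) ^ k, by fun_prop⟩ ν
    simp only [mem_ofPred_eq, Polynomial.toContinuousMapOnAlgHom_apply,
      Polynomial.toContinuousMapOn_apply, Polynomial.toContinuousMap_apply,
      Polynomial.eval_eq_sum_range]
    rw [integral_finsetSum _ fun k _ => hmon ν k, integral_finsetSum _ fun k _ => hmon ν' k]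
    simp_rw [integral_const_mul, h]
  have hall : ∀ f : C(I, ℝ), ∫ x, f x ∂(ν : Measure I) = ∫ x, f x ∂(ν' : Measure I) := fun f => by
    have := closure_minimal hpoly hclosed
    rw [← Subalgebra.topologicalClosure_coe, polynomialFunctions_closure_eq_top'] at this
    exact this (Algebra.mem_top (x := f))
  refine Subtype.ext ?_
  change (ν : Measure I) = (ν' : Measure I)
  exact ext_of_forall_integral_eq_of_IsFiniteMeasure fun f => hall f.toContinuousMap

open unitInterval in
/-- Convergence of all moments implies weak convergence, for laws on `[0, 1]`. -/
theorem exists_tendsto_of_tendsto_moments {ι : Type*} {l : Filter ι} [l.NeBot]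
    {ν : ι → ProbabilityMeasure I} {m : ℕ → ℝ}
    (h : ∀ k : ℕ, Tendsto (fun i => ∫ x, (x : ℝ) ^ k ∂(ν i : Measure I)) l (𝓝 (m k))) :
    ∃ ν₀ : ProbabilityMeasure I, Tendsto ν l (𝓝 ν₀) ∧
      ∀ k : ℕ, ∫ x, (x : ℝ) ^ k ∂(ν₀ : Measure I) = m k := by
  have hlim : ∀ U : Ultrafilter ι, (U : Filter ι) ≤ l → ∃ ν₀ : ProbabilityMeasure I,
      Tendsto ν U (𝓝 ν₀) ∧ ∀ k : ℕ, ∫ x, (x : ℝ) ^ k ∂(ν₀ : Measure I) = m k := by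
    intro U hU
    obtain ⟨ν₀, -, hν₀⟩ := isCompact_univ.ultrafilter_le_nhds (U.map ν) (by simp)
    have hν₀ : Tendsto ν U (𝓝 ν₀) := hν₀
    refine ⟨ν₀, hν₀, fun k => tendsto_nhds_unique ?_ ((h k).mono_left hU)⟩
    exact ProbabilityMeasure.tendsto_iff_forall_integral_tendsto.1 hν₀
      (BoundedContinuousFunction.mkOfCompact ⟨fun x : I => (x : ℝ) ^ k, by fun_prop⟩)
  obtain ⟨ν₀, -, hm⟩ := hlim (Ultrafilter.of l) (Ultrafilter.of_le l)
  refine ⟨ν₀, (tendsto_iff_ultrafilter _ _ _).2 fun U hU => ?_, hm⟩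
  obtain ⟨ν₁, hν₁, hm₁⟩ := hlim U hU
  rwa [probabilityMeasure_eq_of_moments_eq (fun k => (hm k).trans (hm₁ k).symm)]

section Limit

open unitInterval

variable {ν₀ : ProbabilityMeasure I} {α : ℝ}

/-- The moments bound the mass at `1`, and they tend to `0` since `limitExponent α` is unbounded. -/
theorem measure_one_eq_zero_of_moments (hα0 : 0 < α) (hα1 : α < 1)
    (hm : ∀ k : ℕ, ∫ x, (x : ℝ) ^ k ∂(ν₀ : Measure I) = (limitExponent α k)⁻¹) :
    (ν₀ : Measure I) {1} = 0 := by
  have hle : ∀ k : ℕ, (ν₀ : Measure I).real {1} ≤ (limitExponent α k)⁻¹ := fun k => by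
    rw [← hm k, ← integral_indicator_one (measurableSet_singleton _)]
    refine integral_mono ((integrable_const (1 : ℝ)).indicator (measurableSet_singleton _))
      ((BoundedContinuousFunction.mkOfCompact
        (⟨fun x : I => (x : ℝ) ^ k, by fun_prop⟩ : C(I, ℝ))).integrable _) fun x => ?_
    by_cases hx : x = 1
    · simp [hx]
    · rw [indicator_of_notMem (by simpa using hx)]
      exact pow_nonneg x.2.1 k
  have hlim : Tendsto (fun k : ℕ => (limitExponent α k)⁻¹) atTop (𝓝 0) := by
    refine Tendsto.comp tendsto_inv_atTop_zero ?_
    have hc : 0 < 1 - Real.exp (-1) := by rw [sub_pos, Real.exp_lt_one_iff]; norm_num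
    have h1 : Tendsto (fun k : ℕ => (1 - Real.exp (-1)) * (k : ℝ) ^ α) atTop atTop :=
      ((tendsto_rpow_atTop hα0).comp tendsto_natCast_atTop_atTop).const_mul_atTop hc
    refine tendsto_atTop_mono' _ ?_ h1
    filter_upwards [eventually_ge_atTop 1] with k hk
    exact rpow_mul_le_limitExponent hα0.le hα1 (by exact_mod_cast hk)
  have h0 := ge_of_tendsto' hlim hle
  rw [← measureReal_eq_zero_iff]
  exact le_antisymm h0 measureReal_nonneg

/-- The limit law is not a point mass, since `limitExponent α` does not grow exponentially. -/
theorem not_ae_eq_const_of_moments (hα1 : α < 1)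
    (hm : ∀ k : ℕ, ∫ x, (x : ℝ) ^ k ∂(ν₀ : Measure I) = (limitExponent α k)⁻¹) {u : ℝ}
    (hu0 : 0 ≤ u) (hu1 : u < 1) : ¬ ∀ᵐ x : I ∂(ν₀ : Measure I), (x : ℝ) = u := by
  intro hae
  have hpow : ∀ k : ℕ, u ^ k = (limitExponent α k)⁻¹ := fun k => by
    rw [← hm k, integral_congr_ae (g := fun _ => u ^ k)]
    · simp
    · filter_upwards [hae] with x hx
      rw [hx]
  have hone : ∀ k : ℕ, 1 ≤ u ^ k + (1 - α)⁻¹ * (k * u ^ k) := fun k => by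
    have h1 := limitExponent_le hα1 (Nat.cast_nonneg k)
    have h2 : u ^ k * limitExponent α k = 1 := by
      rw [hpow, inv_mul_cancel₀ (limitExponent_pos (Nat.cast_nonneg k)).ne']
    nlinarith [pow_nonneg hu0 k]
  have hlim := (tendsto_pow_atTop_nhds_zero_of_lt_one hu0 hu1).add
    ((tendsto_self_mul_const_pow_of_lt_one hu0 hu1).const_mul (1 - α)⁻¹)
  rw [mul_zero, add_zero] at hlim
  exact absurd (ge_of_tendsto' hlim hone) (by norm_num)

end Limit

section Asymptotics

open unitInterval

variable {ι Ω : Type*} {l : Filter ι} [l.NeBot] [l.IsCountablyGenerated] [MeasurableSpace Ω]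
  {P : Measure Ω} [IsProbabilityMeasure P] {F : Measure ℝ} [IsProbabilityMeasure F] {μ : ι → ℝ}
  {N : ι → Ω → ℕ} {p : ι → ℕ → Ω → ℝ}

/-- The law of `e^{-X}` converges by the method of moments; `1 / X` is a function of `e^{-X}` that
is continuous off the null set `{1}`. -/
theorem exists_tendstoInDistribution_inv_nisr
    (h : ∀ i, IsPoissonSample P F (μ i) (N i) (p i))
    (hμ : Tendsto μ l atTop) {α : ℝ} (hα0 : 0 < α) (hα1 : α < 1)
    (hF : IsRegularlyVarying (tail F) (-α)) {W : ℝ} (hW : 0 ≤ W) :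
    ∃ D : ProbabilityMeasure ℝ, (∀ c : ℝ, (D : Measure ℝ) ≠ Measure.dirac c) ∧
      TendstoInDistribution (fun i ω => (nisr W (N i ω) fun j => p i j ω)⁻¹) l (id : ℝ → ℝ)
        (fun _ => P) (D : Measure ℝ) := by
  let X : ι → Ω → ℝ := fun i ω => nisr W (N i ω) fun j => p i j ω
  have hXm : ∀ i, Measurable (X i) := fun i =>
    measurable_nisr W (h i).measurable_num (h i).measurable_point
  have hX0 : ∀ i, ∀ᵐ ω ∂P, 0 ≤ X i ω := fun i => by
    filter_upwards [(h i).nonneg] with ω hω using nisr_nonneg hW fun j _ => hω j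
  let U : ι → Ω → I := fun i ω => ⟨Real.exp (-|X i ω|), (Real.exp_pos _).le,
    Real.exp_le_one_iff.2 (neg_nonpos.2 (abs_nonneg _))⟩
  have hUm : ∀ i, Measurable (U i) := fun i =>
    Measurable.subtype_mk ((measurable_norm.comp (hXm i)).neg.exp)
  let ν : ι → ProbabilityMeasure I := fun i =>
    ⟨P.map (U i), Measure.isProbabilityMeasure_map (hUm i).aemeasurable⟩
  have hmom : ∀ k : ℕ, Tendsto (fun i => ∫ x, (x : ℝ) ^ k ∂(ν i : Measure I)) l
      (𝓝 (limitExponent α k)⁻¹) := fun k => by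
    refine (tendsto_integral_exp_nisr h hμ hF hα0.le hα1 hW (Nat.cast_nonneg k)).congr fun i => ?_
    have hcont : Continuous fun x : I => (x : ℝ) ^ k := by fun_prop
    change _ = ∫ x, (x : ℝ) ^ k ∂(P.map (U i))
    rw [integral_map (hUm i).aemeasurable hcont.aestronglyMeasurable]
    refine integral_congr_ae ?_
    filter_upwards [hX0 i] with ω hω
    change Real.exp (-(k * X i ω)) = Real.exp (-|X i ω|) ^ k
    rw [abs_of_nonneg hω, ← Real.exp_nat_mul]
    congr 1; ring
  obtain ⟨ν₀, hν₀, hm⟩ := exists_tendsto_of_tendsto_moments hmom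
  have hone := measure_one_eq_zero_of_moments hα0 hα1 hm
  -- `f` is continuous on `[0, 1)`, also at `0`, where its value is the limit `0`
  let f : I → ℝ := fun x => (-Real.log x)⁻¹
  have hfm : Measurable f := (Real.measurable_log.comp measurable_subtype_coe).neg.inv
  have hfc : ∀ x : I, x ≠ 1 → ContinuousAt f x := fun x hx => by
    rcases eq_or_ne x 0 with rfl | h0
    · have hlog : Tendsto (fun x : ℝ => (-Real.log x)⁻¹) (𝓝 0) (𝓝 0) := by
        have h0 : (-Real.log 0)⁻¹ = (0 : ℝ) := by simp
        have : ContinuousAt (fun x : ℝ => (-Real.log x)⁻¹) 0 := by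
          rw [continuousAt_iff_punctured_nhds, h0]
          exact tendsto_inv_atTop_zero.comp
            (tendsto_neg_atBot_atTop.comp Real.tendsto_log_nhdsNE_zero)
        simpa only [ContinuousAt, h0] using this
      change Tendsto f (𝓝 0) (𝓝 (f 0))
      have hf0 : f 0 = 0 := by simp [f]
      rw [hf0]
      exact hlog.comp (continuous_subtype_val.tendsto' (0 : I) 0 rfl)
    · have hx0 : (x : ℝ) ≠ 0 := fun h => h0 (Subtype.ext h)
      have hx1 : (x : ℝ) ≠ 1 := fun h => hx (Subtype.ext h)
      have hxp : 0 < (x : ℝ) := lt_of_le_of_ne x.2.1 hx0.symm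
      refine ContinuousAt.inv₀ ?_ (neg_ne_zero.2 (Real.log_ne_zero_of_pos_of_ne_one hxp hx1))
      exact ((Real.continuousAt_log hx0).comp continuous_subtype_val.continuousAt).neg
  let D : ProbabilityMeasure ℝ := ⟨(ν₀ : Measure I).map f,
    Measure.isProbabilityMeasure_map hfm.aemeasurable⟩
  have hYm : ∀ i, AEMeasurable (fun ω => (X i ω)⁻¹) P := fun i => (hXm i).inv.aemeasurable
  refine ⟨D, fun c hc => ?_, hYm, measurable_id.aemeasurable, ?_⟩
  · -- a degenerate `D` would make the limit law of `U` degenerate, as `f` is injective on `[0, 1)`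
    have hae : ∀ᵐ x ∂(ν₀ : Measure I), f x = c := by
      have : ∀ᵐ y ∂(D : Measure ℝ), y = c := by
        rw [hc]; exact (ae_dirac_iff (measurableSet_singleton c)).2 rfl
      exact ae_of_ae_map hfm.aemeasurable this
    have hne : ∀ᵐ x ∂(ν₀ : Measure I), x ≠ 1 := measure_eq_zero_iff_ae_notMem.1 hone
    have hinj : ∀ x y : I, x ≠ 1 → y ≠ 1 → f x = f y → x = y := by
      intro x y hx hy hxy
      have hlog : Real.log x = Real.log y := neg_injective (inv_injective hxy)
      by_cases h0 : (x : ℝ) = 0 ∨ (y : ℝ) = 0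
      · have hz : ∀ z : I, z ≠ 1 → Real.log z = 0 → (z : ℝ) = 0 := fun z hz hl => by
          rcases Real.log_eq_zero.1 hl with h | h | h
          · exact h
          · exact absurd (Subtype.ext h) hz
          · have := z.2.1; linarith
        rcases h0 with h0 | h0
        · rw [h0, Real.log_zero] at hlog
          exact Subtype.ext (h0.trans (hz y hy hlog.symm).symm)
        · rw [h0, Real.log_zero] at hlog
          exact Subtype.ext ((hz x hx hlog).trans h0.symm)
      · push Not at h0
        exact Subtype.ext (Real.log_injOn_pos (lt_of_le_of_ne x.2.1 h0.1.symm)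
          (lt_of_le_of_ne y.2.1 h0.2.symm) hlog)
    obtain ⟨u, hu1, hu2⟩ := (hne.and hae).exists
    have hu : (u : ℝ) < 1 := lt_of_le_of_ne u.2.2 fun h => hu1 (Subtype.ext h)
    refine not_ae_eq_const_of_moments hα1 hm u.2.1 hu ?_
    filter_upwards [hne, hae] with x hx1 hx2
    rw [hinj x u hx1 hu1 (hx2.trans hu2.symm)]
  · refine tendsto_of_forall_isOpen_le_liminf' fun G hG => ?_
    change ((D : Measure ℝ).map id) G ≤ liminf (fun i => (P.map fun ω => (X i ω)⁻¹) G) l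
    have hopen : IsOpen (f ⁻¹' G ∩ {1}ᶜ) := by
      rw [isOpen_iff_mem_nhds]
      rintro x ⟨hxG, hx1⟩
      exact inter_mem ((hfc x hx1).preimage_mem_nhds (hG.mem_nhds hxG))
        (isOpen_compl_singleton.mem_nhds hx1)
    calc ((D : Measure ℝ).map id) G = (ν₀ : Measure I) (f ⁻¹' G) := by
          rw [Measure.map_id]; exact Measure.map_apply hfm hG.measurableSet
      _ = (ν₀ : Measure I) (f ⁻¹' G ∩ {1}ᶜ) := by
          rw [← sdiff_eq, measure_sdiff_null hone]
      _ ≤ liminf (fun i => (ν i : Measure I) (f ⁻¹' G ∩ {1}ᶜ)) l :=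
          ProbabilityMeasure.le_liminf_measure_open_of_tendsto hν₀ hopen
      _ ≤ liminf (fun i => (P.map fun ω => (X i ω)⁻¹) G) l := by
          refine liminf_le_liminf (Eventually.of_forall fun i => ?_)
          change P.map (U i) _ ≤ _
          rw [Measure.map_apply (hUm i) hopen.measurableSet,
            Measure.map_apply (f := fun ω => (X i ω)⁻¹) (hXm i).inv hG.measurableSet]
          refine measure_mono_ae ?_
          filter_upwards [hX0 i] with ω hω hmem
          have : f (U i ω) ∈ G := hmem.1
          change (X i ω)⁻¹ ∈ G
          simpa [f, U, abs_of_nonneg hω] using this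

end Asymptotics

/-! ### Light tails: almost sure convergence -/

theorem summable_two_pow_mul_of_tendsto_div {H : ℝ → ℝ} (hpos : ∀ x, 0 < x → 0 < H x) {r : ℝ}
    (hr : 2 * r < 1) (hlim : Tendsto (fun x => H (2 * x) / H x) atTop (𝓝 r)) {c : ℝ} (hc : 0 < c) :
    Summable fun n : ℕ => 2 ^ n * H (c * 2 ^ n) := by
  have hp : ∀ n : ℕ, 0 < H (c * 2 ^ n) := fun n => hpos _ (by positivity)
  refine summable_of_ratio_test_tendsto_lt_one hr
    (Eventually.of_forall fun n => (mul_pos (by positivity) (hp n)).ne') ?_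
  have hu : Tendsto (fun n : ℕ => c * 2 ^ n) atTop atTop :=
    (tendsto_pow_atTop_atTop_of_one_lt one_lt_two).const_mul_atTop hc
  refine ((hlim.comp hu).const_mul 2).congr fun n => ?_
  have h1 := hp n
  have h2 := hp (n + 1)
  rw [Real.norm_of_nonneg (by positivity), Real.norm_of_nonneg (by positivity),
    Function.comp_apply, show 2 * (c * 2 ^ n) = c * 2 ^ (n + 1) by ring, pow_succ (2 : ℝ) n]
  rw [pow_succ] at h2
  field_simp

/-- The tail condition yields a finite mean, in the form of a convergent series along the powers of
two. -/
theorem summable_two_pow_mul_tail {F : Measure ℝ} [IsProbabilityMeasure F]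
    (h : (∃ α : ℝ, 1 < α ∧ IsRegularlyVarying (tail F) (-α)) ∨
      ∃ H : ℝ → ℝ, IsRapidlyVarying H ∧ tail F =o[atTop] H) {c : ℝ} (hc : 0 < c) :
    Summable fun n : ℕ => 2 ^ n * tail F (c * 2 ^ n) := by
  rcases h with ⟨α, hα, hF⟩ | ⟨H, hH, ho⟩
  · refine summable_two_pow_mul_of_tendsto_div hF.pos ?_ (hF.lim 2 two_pos) hc
    have : (2 : ℝ) ^ (-α) < 2 ^ (-1 : ℝ) :=
      Real.rpow_lt_rpow_of_exponent_lt one_lt_two (by linarith)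
    rw [Real.rpow_neg_one] at this
    linarith
  · refine summable_of_isBigO_nat
      (summable_two_pow_mul_of_tendsto_div hH.pos (by norm_num) (hH.lim_gt 2 one_lt_two) hc) ?_
    have hu : Tendsto (fun n : ℕ => c * 2 ^ n) atTop atTop :=
      (tendsto_pow_atTop_atTop_of_one_lt one_lt_two).const_mul_atTop hc
    exact (Asymptotics.isBigO_refl _ _).mul (ho.isBigO.comp_tendsto hu)

theorem ae_eventually_notMem_of_summable {Ω : Type*} [MeasurableSpace Ω] {P : Measure Ω}
    [IsFiniteMeasure P] {s : ℕ → Set Ω} {b : ℕ → ℝ} (hs : ∀ n, P.real (s n) ≤ b n)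
    (hb : Summable b) : ∀ᵐ ω ∂P, ∀ᶠ n in atTop, ω ∉ s n := by
  refine ae_eventually_notMem (ne_top_of_le_ne_top hb.tsum_ofReal_ne_top
    (ENNReal.tsum_le_tsum fun n => ?_))
  rw [← ofReal_measureReal]
  exact ENNReal.ofReal_le_ofReal (hs n)

section Dyadic

variable {Ω : Type*} [MeasurableSpace Ω] {P : Measure Ω} [IsProbabilityMeasure P] {F : Measure ℝ}
  [IsProbabilityMeasure F]

/-- In fact `P(M > x) = 1 - exp (-μ F̄(x))`. -/
theorem IsPoissonSample.measureReal_lt_peak_le {μ : ℝ} {N : Ω → ℕ} {p : ℕ → Ω → ℝ}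
    (h : IsPoissonSample P F μ N p) {x : ℝ} (hx : 0 ≤ x) :
    P.real {ω | x < peak (N ω) fun i => p i ω} ≤ μ * tail F x := by
  have hm : MeasurableSet {ω | peak (N ω) (fun i => p i ω) ≤ x} :=
    measurableSet_le (measurable_peak h.measurable_num h.measurable_point) measurable_const
  have h1 : P.real {ω | peak (N ω) (fun i => p i ω) ≤ x} = Real.exp (-(μ * tail F x)) := by
    rw [← h.integral_peak_le hx, ← integral_indicator_one hm]
    rfl
  have h2 : {ω | x < peak (N ω) fun i => p i ω} = {ω | peak (N ω) (fun i => p i ω) ≤ x}ᶜ := by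
    ext ω; simp
  rw [h2, probReal_compl_eq_one_sub hm, h1]
  linarith [Real.one_sub_le_exp_neg (μ * tail F x)]

omit [IsProbabilityMeasure F] in
/-- A Chernoff bound. -/
theorem IsPoissonSample.measureReal_total_le_le {μ : ℝ} {N : Ω → ℕ} {p : ℕ → Ω → ℝ}
    (h : IsPoissonSample P F μ N p) (κ : ℝ) :
    P.real {ω | total (N ω) (fun i => p i ω) ≤ κ} ≤
      Real.exp (κ - μ * ∫ y, (1 - Real.exp (-max y 0)) ∂F) := by
  have hg : Measurable fun y : ℝ => Real.exp (-max y 0) := by fun_prop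
  have hg1 : ∀ y : ℝ, Real.exp (-max y 0) ≤ 1 := fun y =>
    Real.exp_le_one_iff.2 (neg_nonpos.2 (le_max_right _ _))
  have hm : MeasurableSet {ω | total (N ω) (fun i => p i ω) ≤ κ} :=
    measurableSet_le (measurable_total h.measurable_num h.measurable_point) measurable_const
  rw [sub_eq_add_neg, Real.exp_add, ← h.integral_prod _ hg (fun y => (Real.exp_pos _).le) hg1,
    ← integral_const_mul, ← integral_indicator_one hm]
  refine integral_mono_ae ((integrable_const (1 : ℝ)).indicator hm)
    ((h.integrable_prod hg (fun y => (Real.exp_pos _).le) hg1).const_mul _) ?_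
  filter_upwards [h.nonneg] with ω hω
  have hprod : ∏ i ∈ Finset.range (N ω), Real.exp (-max (p i ω) 0)
      = Real.exp (-total (N ω) fun i => p i ω) := by
    rw [total, ← Finset.sum_neg_distrib, Real.exp_sum]
    exact Finset.prod_congr rfl fun i _ => by rw [max_eq_left (hω i)]
  rw [hprod, ← Real.exp_add]
  by_cases hmem : ω ∈ {ω | total (N ω) (fun i => p i ω) ≤ κ}
  · have : total (N ω) (fun i => p i ω) ≤ κ := hmem
    rw [indicator_of_mem hmem]
    exact Real.one_le_exp (by linarith)
  · rw [indicator_of_notMem hmem]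
    exact (Real.exp_pos _).le

theorem integral_one_sub_exp_neg_pos (hF : 0 < tail F 0) :
    0 < ∫ y, (1 - Real.exp (-max y 0)) ∂F := by
  have h0 : ∀ y : ℝ, 0 ≤ 1 - Real.exp (-max y 0) := fun y =>
    sub_nonneg.2 (Real.exp_le_one_iff.2 (neg_nonpos.2 (le_max_right _ _)))
  rw [integral_pos_iff_support_of_nonneg h0]
  · rw [tail_eq_real_Ioi] at hF
    refine (ENNReal.toReal_pos_iff.1 hF).1.trans_le (measure_mono fun y hy => ?_)
    have hy : 0 < y := hy
    rw [Function.mem_support, max_eq_left hy.le]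
    exact (sub_pos.2 (Real.exp_lt_one_iff.2 (neg_lt_zero.2 hy))).ne'
  · refine (integrable_const (1 : ℝ)).mono' (by fun_prop) (ae_of_all _ fun y => ?_)
    rw [Real.norm_of_nonneg (h0 y)]
    linarith [Real.exp_pos (-max y 0)]

variable {v : ℝ} {N : ℕ → Ω → ℕ} {p : ℕ → ℕ → Ω → ℝ}

theorem ae_eventually_peak_le (h : ∀ n, IsPoissonSample P F (2 ^ n * v) (N n) (p n)) {c : ℝ}
    (hc : 0 < c) (hsum : Summable fun n : ℕ => 2 ^ n * tail F (c * 2 ^ n)) :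
    ∀ᵐ ω ∂P, ∀ᶠ n in atTop, peak (N n ω) (fun i => p n i ω) ≤ c * 2 ^ n := by
  have := ae_eventually_notMem_of_summable
    (fun n => (h n).measureReal_lt_peak_le (x := c * 2 ^ n) (by positivity))
    ((hsum.mul_left v).congr fun n => by ring)
  filter_upwards [this] with ω hω
  filter_upwards [hω] with n hn
  exact not_lt.1 hn

theorem ae_eventually_le_total (h : ∀ n, IsPoissonSample P F (2 ^ n * v) (N n) (p n)) (hv : 0 < v)
    (hF : 0 < tail F 0) : ∃ κ : ℝ, 0 < κ ∧
      ∀ᵐ ω ∂P, ∀ᶠ n in atTop, κ * 2 ^ n ≤ total (N n ω) fun i => p n i ω := by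
  have hJ := integral_one_sub_exp_neg_pos hF
  set J := ∫ y, (1 - Real.exp (-max y 0)) ∂F
  have hκ : 0 < v * J / 2 := by positivity
  refine ⟨v * J / 2, hκ, ?_⟩
  have hsum : Summable fun n : ℕ => Real.exp (-(v * J / 2)) ^ n :=
    summable_geometric_of_lt_one (Real.exp_pos _).le (Real.exp_lt_one_iff.2 (by linarith))
  have := ae_eventually_notMem_of_summable
    (fun n => ((h n).measureReal_total_le_le (v * J / 2 * 2 ^ n)).trans (b := _)
      (c := Real.exp (-(v * J / 2)) ^ n) (by
        rw [← Real.exp_nat_mul, Real.exp_le_exp]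
        have : (n : ℝ) ≤ 2 ^ n := by exact_mod_cast (Nat.lt_two_pow_self (n := n)).le
        change v * J / 2 * 2 ^ n - 2 ^ n * v * J ≤ _
        nlinarith)) hsum
  filter_upwards [this] with ω hω
  filter_upwards [hω] with n hn
  exact (not_le.1 hn).le

end Dyadic

/-- Control along the powers of two suffices, by monotonicity. -/
theorem tendsto_div_of_dyadic {M T : ℝ≥0 → ℝ} (hM : Monotone M) (hT : Monotone T)
    (hM0 : ∀ x, 0 ≤ M x) {W κ : ℝ} (hW : 0 ≤ W) (hκ : 0 < κ)
    (hpeak : ∀ c : ℝ, 0 < c → ∀ᶠ n : ℕ in atTop, M (2 ^ n) ≤ c * 2 ^ n)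
    (htotal : ∀ᶠ n : ℕ in atTop, κ * 2 ^ n ≤ T (2 ^ n)) :
    Tendsto (fun x => M x / (T x + W - M x)) atTop (𝓝 0) := by
  rw [Metric.tendsto_nhds]
  intro ε' hε'
  set ε := min ε' 1
  have hε : 0 < ε := lt_min hε' one_pos
  have hε1 : ε ≤ 1 := min_le_right _ _
  obtain ⟨n₀, hn₀⟩ := eventually_atTop.1 ((hpeak (κ * ε / 8) (by positivity)).and htotal)
  filter_upwards [eventually_ge_atTop ((2 : ℝ≥0) ^ n₀)] with x hx
  obtain ⟨n, hnx, hxn⟩ := exists_nat_pow_near ((one_le_pow₀ one_le_two).trans hx) one_lt_two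
  have hn : n₀ ≤ n :=
    Nat.lt_succ_iff.1 ((pow_lt_pow_iff_right₀ (one_lt_two (α := ℝ≥0))).1 (hx.trans_lt hxn))
  have h1 : M x ≤ κ * ε / 8 * 2 ^ (n + 1) := (hM hxn.le).trans (hn₀ (n + 1) (by omega)).1
  have h2 : κ * 2 ^ n ≤ T x := (hn₀ n hn).2.trans (hT hnx)
  have h2n : (0 : ℝ) < 2 ^ n := by positivity
  have hκn : 0 < κ * 2 ^ n := by positivity
  have h3 : M x ≤ ε * (κ * 2 ^ n) / 4 := by rw [pow_succ] at h1; linarith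
  have h4 : ε * (κ * 2 ^ n) ≤ κ * 2 ^ n := mul_le_of_le_one_left hκn.le hε1
  have hden : 0 < T x + W - M x := by linarith
  rw [Real.dist_0_eq_abs, abs_of_nonneg (div_nonneg (hM0 x) hden.le), div_lt_iff₀ hden]
  have h5 : ε * (κ * 2 ^ n / 2) ≤ ε' * (T x + W - M x) :=
    mul_le_mul (min_le_left _ _) (by linarith) (by positivity) hε'.le
  have : 0 < ε * (κ * 2 ^ n) := by positivity
  linarith

namespace MarkedNodes

variable {Ω : Type*} {d : ℕ} {ℓ : MultiSlope d} {Φ Ψ : MarkedNodes Ω d} {ω : Ω}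

theorem mem_config {i : ℕ} (hi : i < Φ.num ω) : (Φ.pos i ω, Φ.mark i ω) ∈ Φ.config ω :=
  Multiset.mem_map_of_mem _ (Multiset.mem_range.2 hi)

theorem exists_of_mem_config {q : EuclideanSpace ℝ (Fin d) × ℝ} (hq : q ∈ Φ.config ω) :
    ∃ i < Φ.num ω, (Φ.pos i ω, Φ.mark i ω) = q := by
  obtain ⟨i, hi, h⟩ := Multiset.mem_map.1 hq
  exact ⟨i, Multiset.mem_range.1 hi, h⟩

theorem totalPower_eq_sum_map : Φ.totalPower ℓ ω = ((Φ.config ω).map ℓ.power).sum := by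
  rw [config, Multiset.map_map]
  rfl

theorem totalPower_mono (h : Φ.config ω ≤ Ψ.config ω) (h0 : ∀ i < Ψ.num ω, 0 ≤ Ψ.rx ℓ i ω) :
    Φ.totalPower ℓ ω ≤ Ψ.totalPower ℓ ω := by
  obtain ⟨u, hu⟩ := Multiset.le_iff_exists_add.1 h
  rw [totalPower_eq_sum_map, totalPower_eq_sum_map, hu, Multiset.map_add, Multiset.sum_add]
  refine le_add_of_nonneg_right (Multiset.sum_nonneg fun y hy => ?_)
  obtain ⟨q, hq, rfl⟩ := Multiset.mem_map.1 hy
  obtain ⟨i, hi, rfl⟩ := exists_of_mem_config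
    (show q ∈ Ψ.config ω by rw [hu]; exact Multiset.mem_add.2 (Or.inr hq))
  exact h0 i hi

theorem maxPower_mono (h : Φ.config ω ≤ Ψ.config ω) (h0 : ∀ i < Ψ.num ω, 0 ≤ Ψ.rx ℓ i ω) :
    Φ.maxPower ℓ ω ≤ Ψ.maxPower ℓ ω := by
  change peak (Φ.num ω) (fun i => Φ.rx ℓ i ω) ≤ peak (Ψ.num ω) fun i => Ψ.rx ℓ i ω
  refine (peak_le_iff (peak_nonneg h0)).2 fun i hi => ?_
  obtain ⟨j, hj, hq⟩ := exists_of_mem_config (Multiset.mem_of_le h (mem_config hi))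
  have := le_peak (fun i => Ψ.rx ℓ i ω) hj
  simp only [rx, hq] at this
  exact this

theorem sinr_eq_inv_nisr (W : ℝ) :
    Φ.sinr ℓ W ω = (nisr W (Φ.num ω) fun i => Φ.rx ℓ i ω)⁻¹ := by
  rw [nisr, inv_div]
  rfl

end MarkedNodes

theorem theorem2 {d : ℕ} (hd : 1 ≤ d) (ℓ : MultiSlope d)
    (Fm : Measure ℝ) [IsProbabilityMeasure Fm] (hFm_nonneg : Fm (Iio 0) = 0)
    (hFm_ne : Fm ≠ Measure.dirac 0) (W : ℝ) (hW : 0 ≤ W)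
    {Ω : Type*} [MeasurableSpace Ω] (P : Measure Ω) [IsProbabilityMeasure P]
    (Φ : ℝ≥0 → MarkedNodes Ω d) (hΦ : ∀ lam, (Φ lam).IsNetwork P ℓ Fm lam) :
    -- slowly varying tail: convergence to infinity in probability
    (IsSlowlyVarying (tail (ℓ.powerLaw Fm)) →
      ∀ y : ℝ, Tendsto (fun lam => P {ω | y < (Φ lam).sinr ℓ W ω}) atTop (𝓝 1)) ∧
    -- regularly varying tail, index in `(-1, 0)`: non-degenerate limit in distribution
    (∀ α : ℝ, 0 < α → α < 1 → IsRegularlyVarying (tail (ℓ.powerLaw Fm)) (-α) →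
      ∃ D : ProbabilityMeasure ℝ, (∀ c : ℝ, (D : Measure ℝ) ≠ Measure.dirac c) ∧
        TendstoInDistribution (fun lam => (Φ lam).sinr ℓ W) atTop (id : ℝ → ℝ)
          (fun _ => P) (D : Measure ℝ)) ∧
    -- lighter tail: if densifying the network only adds nodes, almost sure convergence to zero
    ((∀ᵐ ω ∂P, ∀ lam₁ lam₂ : ℝ≥0, lam₁ ≤ lam₂ → (Φ lam₁).config ω ≤ (Φ lam₂).config ω) →
      ((∃ α : ℝ, 1 < α ∧ IsRegularlyVarying (tail (ℓ.powerLaw Fm)) (-α)) ∨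
        (∃ H : ℝ → ℝ, IsRapidlyVarying H ∧ tail (ℓ.powerLaw Fm) =o[atTop] H)) →
      ∀ᵐ ω ∂P, Tendsto (fun lam => (Φ lam).sinr ℓ W ω) atTop (𝓝 0)) := by
  have := ℓ.isProbabilityMeasure_powerLaw Fm
  set v := (volume ℓ.domain).toReal
  have hv : 0 < v := ENNReal.toReal_pos ℓ.volume_domain_pos.ne' ℓ.volume_domain_ne_top
  have hF0 : 0 < tail (ℓ.powerLaw Fm) 0 := by
    rw [tail_eq_real_Ioi]
    exact ENNReal.toReal_pos (ℓ.powerLaw_Ioi_pos hd Fm hFm_nonneg hFm_ne).ne' (measure_ne_top _ _)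
  have hsample : ∀ lam : ℝ≥0,
      IsPoissonSample P (ℓ.powerLaw Fm) (lam * v) (Φ lam).num ((Φ lam).rx ℓ) :=
    fun lam => (hΦ lam).isPoissonSample hFm_nonneg
  have hμ : Tendsto (fun lam : ℝ≥0 => (lam : ℝ) * v) atTop atTop :=
    (NNReal.tendsto_coe_atTop.2 tendsto_id).atTop_mul_const hv
  refine ⟨fun hF y => ?_, fun α hα0 hα1 hF => ?_, fun hnest hF => ?_⟩
  · simp_rw [MarkedNodes.sinr_eq_inv_nisr]
    exact tendsto_measure_lt_inv_nisr hsample hμ hF hF0 hW y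
  · have heq : (fun lam => (Φ lam).sinr ℓ W) =
        fun lam ω => (nisr W ((Φ lam).num ω) fun i => (Φ lam).rx ℓ i ω)⁻¹ := by
      ext lam ω; exact MarkedNodes.sinr_eq_inv_nisr W
    rw [heq]
    exact exists_tendstoInDistribution_inv_nisr hsample hμ hα0 hα1 hF hW
  · have hdyadic : ∀ n : ℕ, IsPoissonSample P (ℓ.powerLaw Fm) (2 ^ n * v)
        (Φ (2 ^ n)).num ((Φ (2 ^ n)).rx ℓ) := fun n => by simpa using hsample (2 ^ n)
    obtain ⟨κ, hκ, htotal⟩ := ae_eventually_le_total hdyadic hv hF0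
    have hpeak : ∀ᵐ ω ∂P, ∀ m : ℕ, ∀ᶠ n : ℕ in atTop,
        (Φ (2 ^ n)).maxPower ℓ ω ≤ 1 / ((m : ℝ) + 1) * 2 ^ n :=
      ae_all_iff.2 fun m => ae_eventually_peak_le hdyadic (by positivity)
        (summable_two_pow_mul_tail hF (by positivity))
    have hmark : ∀ᵐ ω ∂P, ∀ m : ℕ, ∀ i, 0 ≤ (Φ m).mark i ω :=
      ae_all_iff.2 fun m => (hΦ m).ae_mark_nonneg hFm_nonneg
    filter_upwards [hnest, htotal, hpeak, hmark] with ω hω htω hpω hmω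
    -- nestedness transfers the sign of the fading variables from integer to arbitrary densities
    have h0 : ∀ lam, ∀ i < (Φ lam).num ω, 0 ≤ (Φ lam).rx ℓ i ω := fun lam i hi => by
      obtain ⟨j, -, hj⟩ := MarkedNodes.exists_of_mem_config
        (Multiset.mem_of_le (hω lam ⌈lam⌉₊ (Nat.le_ceil lam)) (MarkedNodes.mem_config hi))
      refine ℓ.power_nonneg ?_
      rw [← hj]
      exact hmω _ j
    refine tendsto_div_of_dyadic (M := fun lam => (Φ lam).maxPower ℓ ω)
      (T := fun lam => (Φ lam).totalPower ℓ ω)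
      (fun a b hab => MarkedNodes.maxPower_mono (hω a b hab) (h0 b))
      (fun a b hab => MarkedNodes.totalPower_mono (hω a b hab) (h0 b))
      (fun lam => peak_nonneg (h0 lam)) hW hκ
      (fun c hc => ?_) htω
    obtain ⟨m, hm⟩ := exists_nat_one_div_lt hc
    filter_upwards [hpω m] with n hn
    exact hn.trans (by gcongr)
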